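/- **Theorem 2.1 (Benign overfitting of SGD).** Let $\mathcal H$ be a real separable Hilbert space (of finite or countably infinite dimension), let $\mathcal D$ be a probability distribution of $(x,y)\in\mathcal H\times\mathbb R$, and let $L(w)=\tfrac12\,\mathbb E_{(x,y)\sim\mathcal D}[(y-\langle w,x\rangle)^2]$. Let $H=\mathbb E[xx^\top]$. Assume: 1. (Regularity) $\mathbb E[xx^\top]$, $\mathbb E[x\otimes x\otimes x\otimes x]$ and $\mathbb E[y^2]$ exist and are finite, $\operatorname{tr}H<\infty$, $H$ is strictly positive definite, and $L$ has a unique global minimizer $w^*$. 2. (Fourth moment) There is a constant $\alpha>0$ with $\mathbb E[xx^\top A\,xx^\top]\preceq\alpha\operatorname{tr}(HA)\,H$ for every positive semidefinite bounded operator $A$. 3. (Noise) $\Sigma=\mathbb E[(y-\langle w^*,x\rangle)^2xx^\top]$ and $\sigma^2=\|H^{-1/2}\Sigma H^{-1/2}\|_2$ (operator norm) exist and are finite. Let $H=\sum_i\lambda_iv_iv_i^\top$ be the eigendecomposition of $H$ in an orthonormal basis $(v_i)_{i\ge1}$, with $\lambda_1\ge\lambda_2\ge\cdots$, and for $k\ge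 0$ put $$\|w\|^2_{H_{0:k}^{-1}}=\sum_{i\le k}\frac{\langle v_i,w\rangle^2}{\lambda_i},\qquad \|w\|^2_{H_{k:\infty}}=\sum_{i>k}\lambda_i\langle v_i,w\rangle^2 .$$ Let $N\ge1$, $w_0\in\mathcal H$, $0<\gamma\le 1/(\alpha\operatorname{tr}H)$, let $(x_1,y_1),\dots,(x_N,y_N)$ be i.i.d. samples from $\mathcal D$, and let $$w_t=w_{t-1}+\gamma\,(y_t-\langle w_{t-1},x_t\rangle)\,x_t\quad(t=1,\dots,N),\qquad \overline w_N=\frac1N\sum_{t=0}^{N-1}w_t .$$ Let $k^*=\max\{k\ge 1:\lambda_k\ge\frac1{\gamma N}\}$, with $k^*=0$ if there is no such $k$. Then $L(\overline w_N)$ is integrable and $$\mathbb E[L(\overline w_N)]-L(w^*)\le 2\cdot\mathrm{EffectiveBias}+2\cdot\mathrm{EffectiveVar},$$ where $$\mathrm{EffectiveBias}=\frac1{\gamma^2N^2}\|w_0-w^*\|^2_{H^{-1}_{0:k^*}}+\|w_0-w^*\|^2_{H_{k^*:\infty}},$$ $$\mathrm{EffectiveVar}=\frac{\alpha\gamma\|w_0-w^*\|_2^2}{1-\gamma\alpha\operatorname{tr}H}\Big(\frac{k^*}{N^2\gamma^2}+\sum_{i>k^*}\lambda_i^2\Big)+\frac{\sigma^2}{1-\gamma\alpha\operatorname{tr}H}\Big(\frac{k^*}{N}+N\gamma^2\sum_{i>k^*}\lambda_i^2\Big).$$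 If $\gamma=1/(\alpha\operatorname{tr}H)$, the quotients with denominator $1-\gamma\alpha\operatorname{tr}H=0$ are read as $a/0=+\infty$ for $a>0$ and $0/0=0$. -/

import Mathlib

open MeasureTheory ProbabilityTheory
open scoped ENNReal

noncomputable section

namespace AveragedSGD

variable {E : Type*} [NormedAddCommGroup E] [InnerProductSpace ℝ E]

/-- The index set `{1, 2, …, d}` (for `d` finite) or `{1, 2, 3, …}` (for `d = ∞`) of an
orthonormal basis of a Hilbert space of dimension `d`. -/
abbrev BasisIndex (d : ℕ∞) : Type := {i : ℕ // 1 ≤ i ∧ (i : ℕ∞) ≤ d}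

/-- The trace `∑ᵢ ⟨vᵢ, T vᵢ⟩`, computed in the orthonormal basis `v`. It does not depend on `v`
when `T` is trace class, which is the case for all operators to which it is applied below
(the second moment operator of finite trace, and its products with bounded operators). -/
def trace {d : ℕ∞} (v : HilbertBasis (BasisIndex d) ℝ E) (T : E →L[ℝ] E) : ℝ :=
  ∑' i, inner ℝ (v i) (T (v i))

/-- `T = ∑ᵢ λᵢ vᵢ vᵢᵀ` with the eigenvalues `λ₁ ≥ λ₂ ≥ …` in non-increasing order. -/
structure IsSortedEigendecomposition {d : ℕ∞} (T : E →L[ℝ] E)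
    (v : HilbertBasis (BasisIndex d) ℝ E) (lam : BasisIndex d → ℝ) : Prop where
  apply_eq : ∀ i, T (v i) = lam i • v i
  antitone : Antitone lam

/-! ### Stochastic gradient descent -/

/-- The SGD iterates `w_t = w_{t-1} + γ (y_t - ⟨w_{t-1}, x_t⟩) x_t` started at `w₀`, where the
sample used in step `t` is `z t = (x_t, y_t)`, `t = 1, 2, …`. -/
def iterate (γ : ℝ) (w₀ : E) (z : ℕ → E × ℝ) : ℕ → E
  | 0 => w₀
  | t + 1 => iterate γ w₀ z t +
      (γ * ((z (t + 1)).2 - inner ℝ (iterate γ w₀ z t) (z (t + 1)).1)) • (z (t + 1)).1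

/-- The averaged iterate `(1 / N) ∑_{t = 0}^{N - 1} w_t`. -/
def average (γ : ℝ) (w₀ : E) (N : ℕ) (z : ℕ → E × ℝ) : E :=
  (1 / (N : ℝ)) • ∑ t ∈ Finset.range N, iterate γ w₀ z t

variable [MeasurableSpace E]

/-- The population risk `L(w) = ½ 𝔼 (y - ⟨w, x⟩)²`. -/
def risk (D : Measure (E × ℝ)) (w : E) : ℝ :=
  (1 / 2) * ∫ z, (z.2 - inner ℝ w z.1) ^ 2 ∂D

/-! ### Moments of the data -/

/-- The second moment operator `H = 𝔼[x xᵀ]`. -/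
def secondMoment (D : Measure (E × ℝ)) : E →L[ℝ] E :=
  ∫ z, InnerProductSpace.rankOne ℝ z.1 z.1 ∂D

/-- The operator `𝔼[x xᵀ A x xᵀ]`. -/
def fourthMoment (D : Measure (E × ℝ)) (A : E →L[ℝ] E) : E →L[ℝ] E :=
  ∫ z, InnerProductSpace.rankOne ℝ z.1 z.1 ∘L A ∘L InnerProductSpace.rankOne ℝ z.1 z.1 ∂D

/-- The gradient noise covariance `Σ = 𝔼[(y - ⟨w⋆, x⟩)² x xᵀ]` at `w⋆`. -/
def noiseCovariance (D : Measure (E × ℝ)) (wStar : E) : E →L[ℝ] E :=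
  ∫ z, ((z.2 - inner ℝ wStar z.1) ^ 2) • InnerProductSpace.rankOne ℝ z.1 z.1 ∂D

/-! ### Assumptions -/

/-- Regularity conditions: the moments of orders two and four of `x` and `𝔼 y²` are finite,
`H = 𝔼[x xᵀ]` has finite trace and is strictly positive definite, and `w⋆` is the unique
minimizer of the risk. -/
structure Regularity {d : ℕ∞} (D : Measure (E × ℝ)) (v : HilbertBasis (BasisIndex d) ℝ E)
    (wStar : E) : Prop where
  memLp_two_x : MemLp (fun z : E × ℝ => z.1) 2 D
  memLp_four_x : MemLp (fun z : E × ℝ => z.1) 4 D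
  memLp_two_y : MemLp (fun z : E × ℝ => z.2) 2 D
  summable_trace : Summable fun i => inner ℝ (v i) (secondMoment D (v i))
  posDef : ∀ u : E, u ≠ 0 → 0 < inner ℝ u (secondMoment D u)
  unique_min : ∀ w : E, w ≠ wStar → risk D wStar < risk D w

/-- Fourth moment condition with constant `α`: `𝔼[x xᵀ A x xᵀ] ⪯ α tr(H A) H` (Loewner order)
for all positive semidefinite `A`. -/
structure FourthMomentBound {d : ℕ∞} (D : Measure (E × ℝ))
    (v : HilbertBasis (BasisIndex d) ℝ E) (α : ℝ) : Prop where
  pos : 0 < α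
  bound : ∀ A : E →L[ℝ] E, A.IsPositive →
    fourthMoment D A ≤ (α * trace v (secondMoment D ∘L A)) • secondMoment D

/-- `R = T^{1/2}` is the positive semidefinite square root of `T`. -/
structure IsPosSqrt (R T : E →L[ℝ] E) : Prop where
  isPositive : R.IsPositive
  comp_self : R ∘L R = T

/-- Noise condition: `Σ` exists, and `S` is the bounded operator `H^{-1/2} Σ H^{-1/2}`, that is,
`H^{1/2} S H^{1/2} = Σ`. As `H` is injective, `H^{1/2}` is injective with dense range, so that at
most one bounded `S` satisfies this; one exists exactly when `H^{-1/2} Σ H^{-1/2}`, which is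
defined on the range of `H^{1/2}`, has finite operator norm, and then that norm is `‖S‖`. -/
structure NoiseCondition (D : Measure (E × ℝ)) (wStar : E) (S : E →L[ℝ] E) : Prop where
  integrable : Integrable (fun z : E × ℝ =>
    ((z.2 - inner ℝ wStar z.1) ^ 2) • InnerProductSpace.rankOne ℝ z.1 z.1) D
  whitened : ∃ R : E →L[ℝ] E, IsPosSqrt R (secondMoment D) ∧
    R ∘L S ∘L R = noiseCovariance D wStar

/-! ### The terms of the bound -/

/-- The effective dimension `k⋆ = max {k : λ_k ≥ 1 / (γ N)}`, which is `0` if no eigenvalue is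
that large. (The set is finite, as the eigenvalues are summable.) -/
def effectiveDim {d : ℕ∞} (lam : BasisIndex d → ℝ) (γ : ℝ) (N : ℕ) : ℕ :=
  sSup {k : ℕ | ∃ i : BasisIndex d, (i : ℕ) = k ∧ lam i ≥ 1 / (γ * N)}

/-- `‖u‖²` in the seminorm of the pseudo-inverse of `H_{0:k}`: `∑_{i ≤ k} ⟨vᵢ, u⟩² / λᵢ`. -/
def headInvNormSq {d : ℕ∞} (v : HilbertBasis (BasisIndex d) ℝ E) (lam : BasisIndex d → ℝ)
    (k : ℕ) (u : E) : ℝ :=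
  ∑' i : BasisIndex d, if (i : ℕ) ≤ k then (inner ℝ (v i) u) ^ 2 / lam i else 0

/-- `‖u‖²` in the seminorm of `H_{k:∞}`: `∑_{i > k} λᵢ ⟨vᵢ, u⟩²`. -/
def tailNormSq {d : ℕ∞} (v : HilbertBasis (BasisIndex d) ℝ E) (lam : BasisIndex d → ℝ)
    (k : ℕ) (u : E) : ℝ :=
  ∑' i : BasisIndex d, if k < (i : ℕ) then lam i * (inner ℝ (v i) u) ^ 2 else 0

/-- `∑_{i > k} λᵢ²`. -/
def tailSqSum {d : ℕ∞} (lam : BasisIndex d → ℝ) (k : ℕ) : ℝ :=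
  ∑' i : BasisIndex d, if k < (i : ℕ) then lam i ^ 2 else 0

/-- `EffectiveBias`, with `u = w₀ - w⋆` and `k = k⋆`. -/
def effectiveBias {d : ℕ∞} (v : HilbertBasis (BasisIndex d) ℝ E) (lam : BasisIndex d → ℝ)
    (γ : ℝ) (N k : ℕ) (u : E) : ℝ :=
  1 / (γ ^ 2 * (N : ℝ) ^ 2) * headInvNormSq v lam k u + tailNormSq v lam k u

/-- `EffectiveVar`, with `u = w₀ - w⋆`, `k = k⋆`, `τ = tr H` and `s = σ²`. All quantities are
nonnegative; the value lies in `[0, ∞]` so that the denominator `1 - γ α tr H` may be `0`, in which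
case the quotient of a positive number by it is `∞`. -/
def effectiveVar {d : ℕ∞} (lam : BasisIndex d → ℝ) (α γ τ s : ℝ) (N k : ℕ) (u : E) : ℝ≥0∞ :=
  ENNReal.ofReal (α * γ * ‖u‖ ^ 2) / ENNReal.ofReal (1 - γ * α * τ) *
      ENNReal.ofReal (k / ((N : ℝ) ^ 2 * γ ^ 2) + tailSqSum lam k) +
    ENNReal.ofReal s / ENNReal.ofReal (1 - γ * α * τ) *
      ENNReal.ofReal (k / (N : ℝ) + N * γ ^ 2 * tailSqSum lam k)

end AveragedSGD

end

set_option linter.unusedSectionVars false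

namespace AveragedSGD

/-! ### Scalar recursions -/

/-! The excess risk is half the `H`-quadratic form of the averaged error. SGD is affine, so the
error is a bias process (started at `w₀ - w⋆`, no noise) plus a variance process (started at `0`,
driven by the residual at `w⋆`), and half the form of a sum is at most the sum of the forms.

Fix one process `e_t` and an eigenpair `(λ, v)` of `H`; put `q = 1 - γλ` and `b_t = 𝔼⟨v, e_t⟩²`. A
fresh sample contracts the conditional mean along `v` by `q`, so times `t ≤ k` have correlation
`q^(k-t) b_t`, and the second moment `V_N` of `∑ ⟨v, e_t⟩` satisfies `(1-q) V_N ≤ 2 (1-q^N) ∑ b_t`.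
The fourth moment and noise conditions give `b_(t+1) ≤ q² b_t + γ²λ m_t` with `m_t = α 𝔼⟨e_t, H e_t⟩
+ s`; if `K` bounds the partial sums of `m`, then `(1-q) ∑ b_t ≤ (1-q^N)(b_0 + γ²λK)`. Hence `(γλ)²
V_N ≤ 2 (1-q^N)² (b_0 + γ²λK)`. Using `1-q^N ≤ 1` in the head and `1-q^N ≤ Nγλ` in the tail
(`eigenvalue_mul_le`) and summing over the eigenbasis bounds the risk for any cutoff `k`
(`NoiseModel.integral_average_le`).

The directions are coupled only through `m_t`, and it remains to find `K`. Without noise, `𝔼‖e_t‖²`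
drops by at least `γ 𝔼⟨e_t, H e_t⟩` per step, so these risks are summable
(`NoiseModel.sum_integral_le_of_noiseless`). Started at `0`, a bound `b_t ≤ c` uniform in all
directions propagates (`NoiseModel.integral_le_of_start_zero`). -/

lemma one_sub_mul_sum_le_of_recursion {q c u K : ℝ} {b m : ℕ → ℝ} {N : ℕ} (hq0 : 0 ≤ q)
    (hc : 0 ≤ c) (hb0 : b 0 ≤ u)
    (hm : ∀ n ≤ N, ∑ t ∈ Finset.range n, m t ≤ K)
    (hrec : ∀ t < N, b (t + 1) ≤ q * b t + c * m t) (hq1 : q ≤ 1) :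
    (1 - q) * ∑ t ∈ Finset.range N, b t ≤ (1 - q ^ N) * (u + c * K) := by
  have key : ∀ n ≤ N, (1 - q) * ∑ t ∈ Finset.range n, b t ≤ (1 - q ^ n) * (u + c * K) := by
    intro n
    induction n with
    | zero => simp
    | succ n ih =>
      intro hn
      have h1 : ∑ t ∈ Finset.range n, b (t + 1) ≤
          q * ∑ t ∈ Finset.range n, b t + c * ∑ t ∈ Finset.range n, m t := by
        rw [Finset.mul_sum, Finset.mul_sum, ← Finset.sum_add_distrib]
        exact Finset.sum_le_sum fun t ht =>
          hrec t (lt_of_lt_of_le (Finset.mem_range.1 ht) (by omega))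
      have h2 := mul_le_mul_of_nonneg_left (hm n (by omega)) hc
      have h3 := mul_le_mul_of_nonneg_left (ih (by omega)) hq0
      rw [Finset.sum_range_succ']
      -- The partial sums of `b` obey the same recursion with constant forcing `u + c * K`, so only
      -- partial sums of `m` matter, not its individual terms.
      have h4 : ∑ t ∈ Finset.range n, b (t + 1) + b 0 ≤
          q * ∑ t ∈ Finset.range n, b t + (u + c * K) := by linarith
      have h5 := mul_le_mul_of_nonneg_left h4 (sub_nonneg.2 hq1)
      rw [pow_succ]
      linarith
  exact key N le_rfl

/-- The sum `2 ∑ (1 - q^(n-t)) b t` grows by at least as much as `(1 - q) * V n` at each step, the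
slack being `(1 - q) * b n`. Its weights are at most `1 - q ^ N`. -/
lemma one_sub_mul_le_of_correlation {q : ℝ} {b V : ℕ → ℝ} {N : ℕ} (hq0 : 0 ≤ q) (hq1 : q ≤ 1)
    (hb : ∀ t, 0 ≤ b t) (hV0 : V 0 = 0)
    (hV : ∀ n < N, V (n + 1) = V n + 2 * ∑ t ∈ Finset.range n, q ^ (n - t) * b t + b n) :
    (1 - q) * V N ≤ 2 * (1 - q ^ N) * ∑ t ∈ Finset.range N, b t := by
  have key : ∀ n ≤ N, (1 - q) * V n ≤ 2 * ∑ t ∈ Finset.range n, (1 - q ^ (n - t)) * b t := by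
    intro n
    induction n with
    | zero => simp [hV0]
    | succ n ih =>
      intro hn
      rw [hV n (by omega), Finset.sum_range_succ]
      have h1 : ∑ t ∈ Finset.range n, (1 - q ^ (n + 1 - t)) * b t =
          ∑ t ∈ Finset.range n, (1 - q ^ (n - t)) * b t +
            (1 - q) * ∑ t ∈ Finset.range n, q ^ (n - t) * b t := by
        rw [Finset.mul_sum, ← Finset.sum_add_distrib]
        refine Finset.sum_congr rfl fun t ht => ?_
        rw [Nat.succ_sub (Finset.mem_range.1 ht).le, pow_succ]
        ring
      have h2 : n + 1 - n = 1 := by omega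
      have h3 := mul_nonneg (sub_nonneg.2 hq1) (hb n)
      rw [h1, h2, pow_one]
      linarith [ih (by omega)]
  refine (key N le_rfl).trans ?_
  rw [mul_assoc, Finset.mul_sum (a := 1 - q ^ N)]
  exact mul_le_mul_of_nonneg_left (Finset.sum_le_sum fun t _ => mul_le_mul_of_nonneg_right
    (sub_le_sub_left (pow_le_pow_of_le_one hq0 hq1 (Nat.sub_le N t)) _) (hb t)) zero_le_two

/-- The second moment of a sum with geometric correlations, weighted by an eigenvalue. -/
lemma eigenvalue_mul_le {γ l u K : ℝ} {b m V : ℕ → ℝ} {N : ℕ} (hN : 0 < N) (hγ : 0 < γ)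
    (hl : 0 < l) (hγl : γ * l ≤ 1) (hK : 0 ≤ K) (hb : ∀ t, 0 ≤ b t) (hb0 : b 0 = u)
    (hm : ∀ n ≤ N, ∑ t ∈ Finset.range n, m t ≤ K)
    (hrec : ∀ t < N, b (t + 1) ≤ (1 - γ * l) ^ 2 * b t + γ ^ 2 * l * m t) (hV0 : V 0 = 0)
    (hV : ∀ n < N, V (n + 1) =
      V n + 2 * ∑ t ∈ Finset.range n, (1 - γ * l) ^ (n - t) * b t + b n) :
    l * (V N / (N : ℝ) ^ 2) ≤ 2 * (1 / (γ ^ 2 * (N : ℝ) ^ 2) * (u / l) + K / (N : ℝ) ^ 2) ∧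
      l * (V N / (N : ℝ) ^ 2) ≤ 2 * (l * u + γ ^ 2 * K * l ^ 2) := by
  have hγl0 : 0 < γ * l := mul_pos hγ hl
  have hN' : (0 : ℝ) < N := by exact_mod_cast hN
  set q := 1 - γ * l with hq
  have hq0 : 0 ≤ q := by linarith
  have hq1 : q ≤ 1 := by linarith
  have hu : 0 ≤ u := hb0 ▸ hb 0
  have h1 : (1 - q) * ∑ t ∈ Finset.range N, b t ≤ (1 - q ^ N) * (u + γ ^ 2 * l * K) := by
    refine one_sub_mul_sum_le_of_recursion hq0 (by positivity) hb0.le hm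
      (fun t ht => (hrec t ht).trans ?_) hq1
    -- Giving up one factor `q` makes the geometric rate agree with that of the correlations.
    have : q ^ 2 ≤ q := by nlinarith
    linarith [mul_le_mul_of_nonneg_right this (hb t)]
  have h2 := one_sub_mul_le_of_correlation hq0 hq1 hb hV0 hV
  have hp0 : 0 ≤ 1 - q ^ N := sub_nonneg.2 (pow_le_one₀ hq0 hq1)
  have hp1 : 1 - q ^ N ≤ 1 := by linarith [pow_nonneg hq0 N]
  have hpN : 1 - q ^ N ≤ N * (γ * l) := by
    have := one_add_mul_le_pow (a := -(γ * l)) (by linarith) N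
    rw [← sub_eq_add_neg] at this
    linarith
  have h1q : 1 - q = γ * l := by rw [hq]; ring
  rw [h1q] at h1 h2
  -- Summation over times and summation over lags each contribute one factor `1 - q ^ N`.
  have h3 : (γ * l) ^ 2 * V N ≤ 2 * ((1 - q ^ N) ^ 2 * (u + γ ^ 2 * l * K)) := by
    have := mul_le_mul_of_nonneg_left h2 hγl0.le
    have := mul_le_mul_of_nonneg_left h1 (mul_nonneg zero_le_two hp0)
    nlinarith
  have hA : 0 ≤ u + γ ^ 2 * l * K := by positivity
  have h4 : l * (V N / (N : ℝ) ^ 2) =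
      (γ * l) ^ 2 * V N / (γ ^ 2 * l * (N : ℝ) ^ 2) := by
    field_simp
  have hden : 0 < γ ^ 2 * l * (N : ℝ) ^ 2 := by positivity
  constructor
  · have : (1 - q ^ N) ^ 2 ≤ 1 := pow_le_one₀ hp0 hp1
    rw [h4, div_le_iff₀ hden]
    refine h3.trans ((mul_le_mul_of_nonneg_left (mul_le_mul_of_nonneg_right this hA)
      zero_le_two).trans_eq ?_)
    field_simp
  · have : (1 - q ^ N) ^ 2 ≤ (N * (γ * l)) ^ 2 := pow_le_pow_left₀ hp0 hpN 2
    rw [h4, div_le_iff₀ hden]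
    refine h3.trans ((mul_le_mul_of_nonneg_left (mul_le_mul_of_nonneg_right this hA)
      zero_le_two).trans_eq ?_)
    ring

end AveragedSGD

namespace AveragedSGD

variable {E : Type*} [NormedAddCommGroup E] [InnerProductSpace ℝ E] [CompleteSpace E]
  [SecondCountableTopology E] [MeasurableSpace E] [BorelSpace E]

/-! ### Moments of the data -/

lemma continuous_rankOne_self : Continuous fun x : E => InnerProductSpace.rankOne ℝ x x :=
  (InnerProductSpace.rankOne ℝ (E := E) (F := E)).continuous.clm_apply continuous_id

lemma integrable_rankOne {D : Measure (E × ℝ)}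
    (h2 : MemLp (fun z : E × ℝ => z.1) 2 D) :
    Integrable (fun z : E × ℝ => InnerProductSpace.rankOne ℝ z.1 z.1) D := by
  refine (h2.integrable_norm_pow (p := 2) two_ne_zero).mono
    (continuous_rankOne_self.comp_stronglyMeasurable
      measurable_fst.stronglyMeasurable).aestronglyMeasurable (ae_of_all _ fun z => ?_)
  simp [sq]

lemma integral_inner_mul_inner {D : Measure (E × ℝ)}
    (h2 : MemLp (fun z : E × ℝ => z.1) 2 D) (u w : E) :
    ∫ z, inner ℝ u z.1 * inner ℝ z.1 w ∂D = inner ℝ u (secondMoment D w) := by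
  have h := ((innerSL ℝ u).comp (ContinuousLinearMap.apply ℝ E w)).integral_comp_comm
    (integrable_rankOne h2)
  simp only [ContinuousLinearMap.comp_apply, ContinuousLinearMap.apply_apply,
    InnerProductSpace.rankOne_apply, innerSL_apply_apply, inner_smul_right] at h
  rw [secondMoment, ← h]
  exact integral_congr_ae (ae_of_all _ fun z => mul_comm _ _)

lemma inner_noiseCovariance {D : Measure (E × ℝ)} {wStar : E}
    (h : Integrable (fun z : E × ℝ =>
      ((z.2 - inner ℝ wStar z.1) ^ 2) • InnerProductSpace.rankOne ℝ z.1 z.1) D) (u : E) :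
    ∫ z, (z.2 - inner ℝ wStar z.1) ^ 2 * inner ℝ u z.1 ^ 2 ∂D =
      inner ℝ u (noiseCovariance D wStar u) := by
  have h := ((innerSL ℝ u).comp (ContinuousLinearMap.apply ℝ E u)).integral_comp_comm h
  simp only [ContinuousLinearMap.comp_apply, ContinuousLinearMap.apply_apply,
    InnerProductSpace.rankOne_apply, innerSL_apply_apply, inner_smul_right,
    smul_apply] at h
  rw [noiseCovariance, ← h]
  refine integral_congr_ae (ae_of_all _ fun z => ?_)
  simp only [real_inner_comm u z.1]
  ring

lemma inner_fourthMoment {D : Measure (E × ℝ)}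
    (h4 : MemLp (fun z : E × ℝ => z.1) 4 D) (u w : E) :
    ∫ z, inner ℝ z.1 u ^ 2 * inner ℝ z.1 w ^ 2 ∂D =
      inner ℝ u (fourthMoment D (InnerProductSpace.rankOne ℝ w w) u) := by
  have hc : Continuous fun x : E => InnerProductSpace.rankOne ℝ x x ∘L
      InnerProductSpace.rankOne ℝ w w ∘L InnerProductSpace.rankOne ℝ x x :=
    continuous_rankOne_self.clm_comp (continuous_const.clm_comp continuous_rankOne_self)
  have hint : Integrable (fun z : E × ℝ => InnerProductSpace.rankOne ℝ z.1 z.1 ∘L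
      InnerProductSpace.rankOne ℝ w w ∘L InnerProductSpace.rankOne ℝ z.1 z.1) D := by
    refine ((h4.integrable_norm_pow (p := 4) (by norm_num)).mul_const (‖w‖ ^ 2)).mono'
      (hc.comp_stronglyMeasurable measurable_fst.stronglyMeasurable).aestronglyMeasurable (ae_of_all _ fun z => ?_)
    refine (ContinuousLinearMap.opNorm_comp_le _ _).trans
      ((mul_le_mul_of_nonneg_left (ContinuousLinearMap.opNorm_comp_le _ _)
        (norm_nonneg _)).trans_eq ?_)
    simp only [InnerProductSpace.norm_rankOne]
    ring
  have h := ((innerSL ℝ u).comp (ContinuousLinearMap.apply ℝ E u)).integral_comp_comm hint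
  simp only [ContinuousLinearMap.comp_apply, ContinuousLinearMap.apply_apply,
    InnerProductSpace.rankOne_apply, innerSL_apply_apply, inner_smul_right] at h
  rw [fourthMoment, ← h]
  refine integral_congr_ae (ae_of_all _ fun z => ?_)
  simp only [real_inner_comm u z.1, real_inner_comm w z.1]
  ring

lemma inner_secondMoment_comm {D : Measure (E × ℝ)}
    (h2 : MemLp (fun z : E × ℝ => z.1) 2 D) (u w : E) :
    inner ℝ u (secondMoment D w) = inner ℝ (secondMoment D u) w := by
  rw [real_inner_comm w, ← integral_inner_mul_inner h2,
    ← integral_inner_mul_inner h2]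
  refine integral_congr_ae (ae_of_all _ fun z => ?_)
  simp only [real_inner_comm u z.1, real_inner_comm w z.1]
  ring

lemma trace_comp_rankOne {d : ℕ∞} (v : HilbertBasis (BasisIndex d) ℝ E) (T : E →L[ℝ] E) (w : E) :
    trace v (T ∘L InnerProductSpace.rankOne ℝ w w) = inner ℝ w (T w) := by
  rw [← (v.hasSum_inner_mul_inner w (T w)).tsum_eq, trace]
  simp [inner_smul_right]

/-- The test operator `w wᵀ` suffices: its trace against `H` is `⟨w, H w⟩`. -/
lemma FourthMomentBound.integral_le {d : ℕ∞} {D : Measure (E × ℝ)}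
    {v : HilbertBasis (BasisIndex d) ℝ E} {α : ℝ} (h : FourthMomentBound D v α)
    (h4 : MemLp (fun z : E × ℝ => z.1) 4 D) (u w : E) :
    ∫ z, inner ℝ z.1 u ^ 2 * inner ℝ z.1 w ^ 2 ∂D ≤
      α * inner ℝ w (secondMoment D w) * inner ℝ u (secondMoment D u) := by
  have h1 := ((ContinuousLinearMap.le_def _ _).1 (h.bound _
    (InnerProductSpace.isPositive_rankOne_self w))).inner_nonneg_right u
  rw [trace_comp_rankOne] at h1
  rw [inner_fourthMoment h4]
  simpa [inner_sub_right, inner_smul_right] using h1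

lemma integrable_mul_of_sq {X : Type*} [MeasurableSpace X] {μ : Measure X} {f g : X → ℝ}
    (hf : AEStronglyMeasurable f μ) (hg : AEStronglyMeasurable g μ)
    (hf2 : Integrable (fun x => f x ^ 2) μ) (hg2 : Integrable (fun x => g x ^ 2) μ) :
    Integrable (fun x => f x * g x) μ :=
  ((memLp_two_iff_integrable_sq hf).2 hf2).integrable_mul ((memLp_two_iff_integrable_sq hg).2 hg2)

lemma integrable_inner_sq {D : Measure (E × ℝ)}
    (h2 : MemLp (fun z : E × ℝ => z.1) 2 D) (u : E) :
    Integrable (fun z : E × ℝ => inner ℝ u z.1 ^ 2) D := by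
  refine ((h2.integrable_norm_pow (p := 2) two_ne_zero).const_mul (‖u‖ ^ 2)).mono'
    (by fun_prop) (ae_of_all _ fun z => ?_)
  rw [← mul_pow, Real.norm_of_nonneg (sq_nonneg _), ← sq_abs]
  gcongr
  exact abs_real_inner_le_norm _ _

lemma integrable_residual_sq {D : Measure (E × ℝ)} (h2 : MemLp (fun z : E × ℝ => z.1) 2 D)
    (hy : MemLp (fun z : E × ℝ => z.2) 2 D) (w : E) :
    Integrable (fun z : E × ℝ => (z.2 - inner ℝ w z.1) ^ 2) D := by
  have h1 : MemLp (fun z : E × ℝ => inner ℝ w z.1) 2 D :=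
    (memLp_two_iff_integrable_sq (by fun_prop)).2 (integrable_inner_sq h2 w)
  exact (hy.sub h1).integrable_sq

lemma risk_add {D : Measure (E × ℝ)} (h2 : MemLp (fun z : E × ℝ => z.1) 2 D)
    (hy : MemLp (fun z : E × ℝ => z.2) 2 D) (w u : E) :
    risk D (w + u) = risk D w - ∫ z, (z.2 - inner ℝ w z.1) * inner ℝ u z.1 ∂D +
      (1 / 2) * inner ℝ u (secondMoment D u) := by
  have hr := integrable_residual_sq h2 hy w
  have hu := integrable_inner_sq h2 u
  have hru : Integrable (fun z : E × ℝ => (z.2 - inner ℝ w z.1) * inner ℝ u z.1) D :=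
    integrable_mul_of_sq (by fun_prop) (by fun_prop) hr hu
  have h1 : ∀ z : E × ℝ, (z.2 - inner ℝ (w + u) z.1) ^ 2 = (z.2 - inner ℝ w z.1) ^ 2 -
      2 * ((z.2 - inner ℝ w z.1) * inner ℝ u z.1) + inner ℝ u z.1 ^ 2 := by
    intro z
    rw [inner_add_left]
    ring
  have h3 : ∫ z, inner ℝ u z.1 ^ 2 ∂D = inner ℝ u (secondMoment D u) := by
    rw [← integral_inner_mul_inner h2]
    refine integral_congr_ae (ae_of_all _ fun z => ?_)
    simp only [real_inner_comm u z.1]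
    ring
  have hsub : Integrable (fun z : E × ℝ => (z.2 - inner ℝ w z.1) ^ 2 -
      2 * ((z.2 - inner ℝ w z.1) * inner ℝ u z.1)) D := hr.sub (hru.const_mul 2)
  simp only [risk, h1]
  rw [integral_add hsub hu, integral_sub hr (hru.const_mul 2),
    integral_const_mul, h3]
  ring

/-- First-order optimality: the residual at a minimizer of the risk is uncorrelated with `x`. -/
lemma integral_residual_mul_inner_eq_zero {D : Measure (E × ℝ)} {w : E}
    (h2 : MemLp (fun z : E × ℝ => z.1) 2 D) (hy : MemLp (fun z : E × ℝ => z.2) 2 D)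
    (hmin : ∀ w', risk D w ≤ risk D w') (u : E) :
    ∫ z, (z.2 - inner ℝ w z.1) * inner ℝ u z.1 ∂D = 0 := by
  set I := ∫ z, (z.2 - inner ℝ w z.1) * inner ℝ u z.1 ∂D with hI
  set q := inner ℝ u (secondMoment D u)
  have h1 : ∀ t : ℝ, 0 ≤ -(t * I) + (1 / 2) * (t ^ 2 * q) := by
    intro t
    have h := hmin (w + t • u)
    rw [risk_add h2 hy] at h
    have e1 : ∫ z, (z.2 - inner ℝ w z.1) * inner ℝ (t • u) z.1 ∂D = t * I := by
      rw [hI, ← integral_const_mul]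
      refine integral_congr_ae (ae_of_all _ fun z => ?_)
      simp only [real_inner_smul_left]
      ring
    have e2 : inner ℝ (t • u) (secondMoment D (t • u)) = t ^ 2 * q := by
      rw [map_smul, real_inner_smul_left, real_inner_smul_right]
      ring
    rw [e1, e2] at h
    linarith
  have hq : 0 ≤ q := by
    have a := h1 1
    have b := h1 (-1)
    linarith
  by_contra hne
  -- Dividing by `1 + q` instead of `q` keeps the test point valid when `q = 0`, and the quadratic
  -- is still negative there.
  have h := h1 (I / (1 + q))
  have e : -(I / (1 + q) * I) + 1 / 2 * ((I / (1 + q)) ^ 2 * q) =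
      -(I ^ 2 * (1 + q / 2)) / (1 + q) ^ 2 := by
    field_simp
    ring
  rw [e] at h
  have : 0 < I ^ 2 * (1 + q / 2) / (1 + q) ^ 2 := by positivity
  rw [neg_div] at h
  linarith

lemma risk_sub_risk {D : Measure (E × ℝ)} {wStar : E}
    (h2 : MemLp (fun z : E × ℝ => z.1) 2 D) (hy : MemLp (fun z : E × ℝ => z.2) 2 D)
    (hmin : ∀ w', risk D wStar ≤ risk D w') (w : E) :
    risk D w = risk D wStar + (1 / 2) * inner ℝ (w - wStar) (secondMoment D (w - wStar)) := by
  have h := risk_add h2 hy wStar (w - wStar)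
  rw [integral_residual_mul_inner_eq_zero h2 hy hmin, add_sub_cancel, sub_zero] at h
  exact h

/-- With `Σ = R S R`, `R` symmetric and `R² = H`, the form of `Σ` at `u` is that of `S` at `R u`,
and `‖R u‖² = ⟨u, H u⟩`. -/
lemma NoiseCondition.integral_le {D : Measure (E × ℝ)} {wStar : E} {S : E →L[ℝ] E}
    (h : NoiseCondition D wStar S) (u : E) :
    ∫ z, (z.2 - inner ℝ wStar z.1) ^ 2 * inner ℝ u z.1 ^ 2 ∂D ≤
      ‖S‖ * inner ℝ u (secondMoment D u) := by
  obtain ⟨R, hR, hS⟩ := h.whitened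
  rw [inner_noiseCovariance h.integrable, ← hS, ← hR.comp_self]
  have hsymm : ∀ a, inner ℝ u (R a) = inner ℝ (R u) a := fun a =>
    (hR.isPositive.isSymmetric u a).symm
  simp only [ContinuousLinearMap.comp_apply, hsymm]
  rw [real_inner_self_eq_norm_sq]
  calc inner ℝ (R u) (S (R u)) ≤ ‖R u‖ * ‖S (R u)‖ := real_inner_le_norm _ _
    _ ≤ ‖R u‖ * (‖S‖ * ‖R u‖) := by gcongr; exact S.le_opNorm _
    _ = ‖S‖ * ‖R u‖ ^ 2 := by ring

lemma NoiseCondition.integrable_mul {D : Measure (E × ℝ)} {wStar : E} {S : E →L[ℝ] E}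
    (h : NoiseCondition D wStar S) :
    Integrable (fun z : E × ℝ => (z.2 - inner ℝ wStar z.1) ^ 2 * ‖z.1‖ ^ 2) D := by
  refine h.integrable.norm.congr (ae_of_all _ fun z => ?_)
  simp [norm_smul, sq]

end AveragedSGD

noncomputable section

namespace AveragedSGD

variable {E : Type*} [NormedAddCommGroup E] [InnerProductSpace ℝ E] [CompleteSpace E]
  [SecondCountableTopology E] [MeasurableSpace E] [BorelSpace E]

/-! ### A single step of the error recursion -/

/-- The moment conditions on the covariates `x` and an observation noise `ζ` under which the SGD
errors are analysed, with `H` the second moment operator of `x`. -/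
structure NoiseModel (D : Measure (E × ℝ)) (H : E →L[ℝ] E) (α s : ℝ) (ζ : E × ℝ → ℝ) : Prop where
  measurable : Measurable ζ
  integrable_two : Integrable (fun z : E × ℝ => ‖z.1‖ ^ 2) D
  integrable_four : Integrable (fun z : E × ℝ => ‖z.1‖ ^ 4) D
  integrable_noise : Integrable (fun z : E × ℝ => ζ z ^ 2 * ‖z.1‖ ^ 2) D
  second : ∀ u w, ∫ z, inner ℝ u z.1 * inner ℝ z.1 w ∂D = inner ℝ u (H w)
  fourth : ∀ u w, ∫ z, inner ℝ z.1 u ^ 2 * inner ℝ z.1 w ^ 2 ∂D ≤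
    α * inner ℝ w (H w) * inner ℝ u (H u)
  centered : ∀ u, ∫ z, ζ z * inner ℝ u z.1 ∂D = 0
  noise : ∀ u, ∫ z, ζ z ^ 2 * inner ℝ u z.1 ^ 2 ∂D ≤ s * inner ℝ u (H u)

/-- One SGD step from `e` on the covariate `z.1` and the observation `ζ z`. -/
def next (γ : ℝ) (ζ : E × ℝ → ℝ) (e : E) (z : E × ℝ) : E :=
  e + (γ * (ζ z - inner ℝ e z.1)) • z.1

lemma inner_next (γ : ℝ) (ζ : E × ℝ → ℝ) (u e : E) (z : E × ℝ) :
    inner ℝ u (next γ ζ e z) =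
      inner ℝ u e + γ * (ζ z * inner ℝ u z.1 - inner ℝ u z.1 * inner ℝ z.1 e) := by
  rw [next, inner_add_right, inner_smul_right, real_inner_comm z.1 e]
  ring

/-- Separates the current error from the sample, so that integrability of the next error follows
from independence. -/
lemma norm_next_sq_le {γ : ℝ} (hγ : 0 ≤ γ) (ζ : E × ℝ → ℝ) (e : E) (z : E × ℝ) :
    ‖next γ ζ e z‖ ^ 2 ≤
      ‖e‖ ^ 2 * (2 * (1 + γ * ‖z.1‖ ^ 2) ^ 2) + 2 * γ ^ 2 * (ζ z ^ 2 * ‖z.1‖ ^ 2) := by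
  have h1 : ‖next γ ζ e z‖ ≤ ‖e‖ * (1 + γ * ‖z.1‖ ^ 2) + γ * (|ζ z| * ‖z.1‖) := by
    refine (norm_add_le _ _).trans ?_
    rw [norm_smul, norm_mul, Real.norm_of_nonneg hγ]
    have h2 : ‖ζ z - inner ℝ e z.1‖ ≤ |ζ z| + ‖e‖ * ‖z.1‖ :=
      (norm_sub_le _ _).trans (by gcongr; exacts [le_rfl, norm_inner_le_norm _ _])
    have h3 := mul_le_mul_of_nonneg_right (mul_le_mul_of_nonneg_left h2 hγ) (norm_nonneg z.1)
    linarith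
  refine (pow_le_pow_left₀ (norm_nonneg _) h1 2).trans ?_
  refine (add_sq_le (a := ‖e‖ * (1 + γ * ‖z.1‖ ^ 2)) (b := γ * (|ζ z| * ‖z.1‖))).trans_eq ?_
  rw [mul_pow γ, mul_pow |ζ z|, sq_abs]
  ring

namespace NoiseModel

variable {D : Measure (E × ℝ)} [IsProbabilityMeasure D] {H : E →L[ℝ] E} {α s : ℝ}
  {ζ : E × ℝ → ℝ}

lemma measurable_next (h : NoiseModel D H α s ζ) (γ : ℝ) :
    Measurable fun p : E × E × ℝ => next γ ζ p.1 p.2 := by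
  have := h.measurable
  unfold next
  fun_prop

lemma memLp_noise_mul_inner (h : NoiseModel D H α s ζ) (u : E) :
    MemLp (fun z : E × ℝ => ζ z * inner ℝ u z.1) 2 D := by
  have hm := h.measurable
  refine (memLp_two_iff_integrable_sq (by fun_prop)).2
    ((h.integrable_noise.const_mul (‖u‖ ^ 2)).mono' (by fun_prop) (ae_of_all _ fun z => ?_))
  rw [Real.norm_of_nonneg (sq_nonneg _), mul_pow]
  have : inner ℝ u z.1 ^ 2 ≤ (‖u‖ * ‖z.1‖) ^ 2 := by
    rw [← sq_abs]
    gcongr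
    exact abs_real_inner_le_norm _ _
  refine (mul_le_mul_of_nonneg_left this (sq_nonneg _)).trans_eq ?_
  ring

lemma memLp_inner_mul_inner (h : NoiseModel D H α s ζ) (u w : E) :
    MemLp (fun z : E × ℝ => inner ℝ u z.1 * inner ℝ z.1 w) 2 D := by
  refine (memLp_two_iff_integrable_sq (by fun_prop)).2
    ((h.integrable_four.const_mul (‖u‖ ^ 2 * ‖w‖ ^ 2)).mono' (by fun_prop)
      (ae_of_all _ fun z => ?_))
  rw [Real.norm_of_nonneg (sq_nonneg _), ← sq_abs, abs_mul]
  have : |inner ℝ u z.1| * |inner ℝ z.1 w| ≤ (‖u‖ * ‖z.1‖) * (‖z.1‖ * ‖w‖) := by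
    gcongr <;> exact abs_real_inner_le_norm _ _
  refine (pow_le_pow_left₀ (by positivity) this 2).trans_eq ?_
  ring

lemma integral_inner_next (h : NoiseModel D H α s ζ) (γ : ℝ) (u e : E) :
    ∫ z, inner ℝ u (next γ ζ e z) ∂D = inner ℝ u e - γ * inner ℝ u (H e) := by
  have h1 := (h.memLp_noise_mul_inner u).integrable one_le_two
  have h2 := (h.memLp_inner_mul_inner u e).integrable one_le_two
  have h3 : Integrable (fun z : E × ℝ => γ * (ζ z * inner ℝ u z.1 -
    inner ℝ u z.1 * inner ℝ z.1 e)) D := (h1.sub h2).const_mul γ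
  simp only [inner_next]
  rw [integral_add (integrable_const _) h3, integral_const_mul, integral_sub h1 h2,
    h.centered, h.second]
  simp
  ring

/-- The mixed third moment `𝔼[ζ ⟨u, x⟩² x]`. -/
def _root_.AveragedSGD.mixedMoment (D : Measure (E × ℝ)) (ζ : E × ℝ → ℝ) (u : E) : E :=
  ∫ z, (ζ z * inner ℝ u z.1 ^ 2) • z.1 ∂D

/-- Exhibits the cross term between noise and signal as a linear functional of `e`, which vanishes
once `e` has mean zero. The third-order moment exists because `2ab ≤ a² + b²` with `a = |ζ|‖x‖`, `b
= ‖x‖²`. -/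
lemma inner_mixedMoment (h : NoiseModel D H α s ζ) (u e : E) :
    ∫ z, (ζ z * inner ℝ u z.1) * (inner ℝ u z.1 * inner ℝ z.1 e) ∂D =
      inner ℝ e (mixedMoment D ζ u) := by
  have hm := h.measurable
  have hint : Integrable (fun z : E × ℝ => (ζ z * inner ℝ u z.1 ^ 2) • z.1) D := by
    refine ((h.integrable_noise.add h.integrable_four).const_mul (‖u‖ ^ 2)).mono'
      (by fun_prop) (ae_of_all _ fun z => ?_)
    have h1 : inner ℝ u z.1 ^ 2 ≤ (‖u‖ * ‖z.1‖) ^ 2 := by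
      rw [← sq_abs]
      gcongr
      exact abs_real_inner_le_norm _ _
    have h2 := two_mul_le_add_sq (|ζ z| * ‖z.1‖) (‖z.1‖ ^ 2)
    have h3 : 0 ≤ (|ζ z| * ‖z.1‖) * ‖z.1‖ ^ 2 := by positivity
    rw [mul_pow, sq_abs] at h2
    rw [norm_smul, norm_mul, Real.norm_of_nonneg (sq_nonneg (inner ℝ u z.1)), Real.norm_eq_abs]
    simp only [Pi.add_apply]
    calc |ζ z| * inner ℝ u z.1 ^ 2 * ‖z.1‖ ≤ |ζ z| * (‖u‖ * ‖z.1‖) ^ 2 * ‖z.1‖ := by gcongr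
      _ = ‖u‖ ^ 2 * ((|ζ z| * ‖z.1‖) * ‖z.1‖ ^ 2) := by ring
      _ ≤ ‖u‖ ^ 2 * (ζ z ^ 2 * ‖z.1‖ ^ 2 + ‖z.1‖ ^ 4) := by
        gcongr
        linarith
  rw [mixedMoment, ← integral_inner hint e]
  refine integral_congr_ae (ae_of_all _ fun z => ?_)
  simp only [inner_smul_right, real_inner_comm e z.1]
  ring

/-- After expanding the square, centering removes the linear noise term and the moment conditions
bound the two squares. The cross term is kept exactly, to be removed after averaging over `e`. -/
lemma integral_inner_next_sq_le (h : NoiseModel D H α s ζ) (γ : ℝ) (u e : E) :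
    ∫ z, inner ℝ u (next γ ζ e z) ^ 2 ∂D ≤
      inner ℝ u e ^ 2 - 2 * γ * inner ℝ u e * inner ℝ u (H e) +
        γ ^ 2 * inner ℝ u (H u) * (α * inner ℝ e (H e) + s) -
        2 * γ ^ 2 * inner ℝ e (mixedMoment D ζ u) := by
  set c := inner ℝ u e
  set X : E × ℝ → ℝ := fun z => ζ z * inner ℝ u z.1
  set Y : E × ℝ → ℝ := fun z => inner ℝ u z.1 * inner ℝ z.1 e
  have hX : MemLp X 2 D := h.memLp_noise_mul_inner u
  have hY : MemLp Y 2 D := h.memLp_inner_mul_inner u e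
  have iX := hX.integrable one_le_two
  have iY := hY.integrable one_le_two
  have iXY : Integrable (fun z => X z * Y z) D := hX.integrable_mul hY
  have i1 : Integrable (fun z => 2 * γ * c * (X z - Y z)) D := (iX.sub iY).const_mul _
  have i2 : Integrable (fun z => γ ^ 2 * (X z ^ 2 + Y z ^ 2)) D :=
    (hX.integrable_sq.add hY.integrable_sq).const_mul _
  have i3 : Integrable (fun z => 2 * γ ^ 2 * (X z * Y z)) D := iXY.const_mul _
  have i01 : Integrable (fun z => c ^ 2 + 2 * γ * c * (X z - Y z)) D :=
    (integrable_const _).add i1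
  have i012 : Integrable (fun z => c ^ 2 + 2 * γ * c * (X z - Y z) +
    γ ^ 2 * (X z ^ 2 + Y z ^ 2)) D := i01.add i2
  have e1 : ∀ z, inner ℝ u (next γ ζ e z) ^ 2 = c ^ 2 + 2 * γ * c * (X z - Y z) +
      γ ^ 2 * (X z ^ 2 + Y z ^ 2) - 2 * γ ^ 2 * (X z * Y z) := by
    intro z
    rw [inner_next]
    ring
  have eX : ∫ z, X z ∂D = 0 := h.centered u
  have eY : ∫ z, Y z ∂D = inner ℝ u (H e) := h.second u e
  have eXY : ∫ z, X z * Y z ∂D = inner ℝ e (mixedMoment D ζ u) := h.inner_mixedMoment u e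
  have lX : ∫ z, X z ^ 2 ∂D ≤ s * inner ℝ u (H u) := by
    simpa only [X, mul_pow] using h.noise u
  have lY : ∫ z, Y z ^ 2 ∂D ≤ α * inner ℝ e (H e) * inner ℝ u (H u) := by
    have := h.fourth u e
    simp only [real_inner_comm u] at this
    simpa only [Y, mul_pow] using this
  simp only [e1]
  rw [integral_sub i012 i3, integral_add i01 i2, integral_add (integrable_const _) i1,
    integral_const_mul, integral_const_mul, integral_const_mul, integral_sub iX iY,
    integral_add hX.integrable_sq hY.integrable_sq, eX, eY, eXY]
  have := mul_le_mul_of_nonneg_left (add_le_add lX lY) (sq_nonneg γ)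
  simp only [integral_const, probReal_univ, one_smul]
  linarith

end NoiseModel

/-! ### Independent samples and the error process -/

lemma iterate_congr {γ : ℝ} {u : E} {z z' : ℕ → E × ℝ} {t : ℕ}
    (h : ∀ r, 1 ≤ r → r ≤ t → z r = z' r) : iterate γ u z t = iterate γ u z' t := by
  induction t with
  | zero => rfl
  | succ t ih =>
    rw [iterate, iterate, ih fun r h1 h2 => h r h1 (by omega), h (t + 1) (by omega) le_rfl]

lemma measurable_iterate {X : Type*} [MeasurableSpace X] {γ : ℝ} {u : E} {z : ℕ → X → E × ℝ}
    (hz : ∀ t, Measurable (z t)) (t : ℕ) :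
    Measurable fun x => iterate γ u (fun r => z r x) t := by
  induction t with
  | zero => exact measurable_const
  | succ t ih =>
    have := hz (t + 1)
    simp only [iterate]
    fun_prop

/-- Measurable i.i.d. samples `Z 1, …, Z N` with distribution `D`. -/
structure Samples {Ω : Type*} [MeasurableSpace Ω] (D : Measure (E × ℝ)) (P : Measure Ω) (N : ℕ)
    (Z : ℕ → Ω → E × ℝ) : Prop where
  measurable : ∀ t, Measurable (Z t)
  map_eq : ∀ t ∈ Set.Icc 1 N, P.map (Z t) = D
  indep : iIndepFun (fun t : Set.Icc 1 N => Z t) P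

/-- The SGD iterates started at `u`, run on the observations `ζ z` in place of the responses. -/
def err {Ω : Type*} (γ : ℝ) (u : E) (ζ : E × ℝ → ℝ) (Z : ℕ → Ω → E × ℝ) (t : ℕ) (ω : Ω) : E :=
  iterate γ u (fun r => ((Z r ω).1, ζ (Z r ω))) t

lemma err_succ {Ω : Type*} (γ : ℝ) (u : E) (ζ : E × ℝ → ℝ) (Z : ℕ → Ω → E × ℝ) (t : ℕ) (ω : Ω) :
    err γ u ζ Z (t + 1) ω = next γ ζ (err γ u ζ Z t ω) (Z (t + 1) ω) := rfl

variable {Ω : Type*} [MeasurableSpace Ω] {P : Measure Ω} [IsProbabilityMeasure P]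
  {D : Measure (E × ℝ)} [IsProbabilityMeasure D] {N : ℕ} {Z : ℕ → Ω → E × ℝ}
  {ζ : E × ℝ → ℝ}

lemma Samples.measurable_err (hZ : Samples D P N Z) (hζ : Measurable ζ) (γ : ℝ) (u : E) (t : ℕ) :
    Measurable (err γ u ζ Z t) := by
  have := hZ.measurable
  exact measurable_iterate (z := fun r ω => ((Z r ω).1, ζ (Z r ω))) (fun r => by fun_prop) t

/-- Errors up to time `k` are functions of the samples `1, …, k` only. Two times are kept so that
correlations are covered as well as squares. -/
lemma Samples.indepFun_err (hZ : Samples D P N Z) (hζ : Measurable ζ) (γ : ℝ) (u : E) {t k : ℕ}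
    (htk : t ≤ k) (hk : k < N) :
    IndepFun (fun ω => (err γ u ζ Z t ω, err γ u ζ Z k ω)) (Z (k + 1)) P := by
  classical
  let S : Finset (Set.Icc 1 N) := Finset.univ.filter fun r => (r : ℕ) ≤ k
  let j : Set.Icc 1 N := ⟨k + 1, by simp; omega⟩
  have hdisj : Disjoint S {j} := by
    rw [Finset.disjoint_singleton_right]
    simp [S, j]
  have hind := hZ.indep.indepFun_finset S {j} hdisj fun r => hZ.measurable r
  -- Rebuilds the sample sequence from its entries up to `k`; the default `0` elsewhere is never
  -- read by the iterates in question.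
  let ext : ℕ → (S → E × ℝ) → E × ℝ := fun r p =>
    if h : r ∈ Set.Icc 1 N ∧ r ≤ k then
      ((p ⟨⟨r, h.1⟩, by simp [S, h.2]⟩).1, ζ (p ⟨⟨r, h.1⟩, by simp [S, h.2]⟩)) else 0
  have hext : ∀ r, Measurable (ext r) := by
    intro r
    by_cases h : r ∈ Set.Icc 1 N ∧ r ≤ k
    · simp only [ext, h, and_self, dite_true]
      fun_prop
    · simp only [ext, h, dite_false]
      exact measurable_const
  have hφ : Measurable fun p : S → E × ℝ =>
      (iterate γ u (fun r => ext r p) t, iterate γ u (fun r => ext r p) k) :=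
    (measurable_iterate hext t).prodMk (measurable_iterate hext k)
  have hψ : Measurable fun p : ({j} : Finset (Set.Icc 1 N)) → E × ℝ =>
      p ⟨j, Finset.mem_singleton_self j⟩ := measurable_pi_apply _
  have heq : ∀ ω r, 1 ≤ r → r ≤ k →
      ext r (fun i : S => Z i ω) = ((Z r ω).1, ζ (Z r ω)) := by
    intro ω r h1 h2
    have h : r ∈ Set.Icc 1 N ∧ r ≤ k := ⟨⟨h1, by omega⟩, h2⟩
    simp only [ext, h, and_self, dite_true]
  have := hind.comp hφ hψ
  convert this using 1
  · funext ω
    exact Prod.ext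
      (iterate_congr fun r h1 h2 => (heq ω r h1 (h2.trans htk)).symm)
      (iterate_congr fun r h1 h2 => (heq ω r h1 h2).symm)
  · rfl

/-- Fubini on the product law plays the role of conditioning on the past. -/
lemma integral_eq_of_indepFun {F G : Type*} [MeasurableSpace F] [MeasurableSpace G]
    {μ : Measure G} [IsProbabilityMeasure μ]
    {W : Ω → F} {Y : Ω → G} (hW : Measurable W) (hY : Measurable Y) (hind : IndepFun W Y P)
    (hlaw : P.map Y = μ) {f : F → G → ℝ} (hf : Measurable fun p : F × G => f p.1 p.2)
    (hint : Integrable (fun ω => f (W ω) (Y ω)) P) :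
    Integrable (fun ω => ∫ y, f (W ω) y ∂μ) P ∧
      ∫ ω, f (W ω) (Y ω) ∂P = ∫ ω, ∫ y, f (W ω) y ∂μ ∂P := by
  have hmap := (indepFun_iff_map_prod_eq_prod_map_map hW.aemeasurable hY.aemeasurable).1 hind
  rw [hlaw] at hmap
  have : IsProbabilityMeasure (P.map W) := Measure.isProbabilityMeasure_map hW.aemeasurable
  have hWY : Measurable fun ω => (W ω, Y ω) := hW.prodMk hY
  have hi : Integrable (fun p : F × G => f p.1 p.2) ((P.map W).prod μ) := by
    rw [← hmap, integrable_map_measure hf.aestronglyMeasurable hWY.aemeasurable]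
    exact hint
  have hi' := hi.integral_prod_left
  constructor
  · exact (integrable_map_measure hi'.aestronglyMeasurable hW.aemeasurable).1 hi'
  · have h1 : ∫ ω, f (W ω) (Y ω) ∂P = ∫ p, f p.1 p.2 ∂((P.map W).prod μ) := by
      rw [← hmap, integral_map hWY.aemeasurable hf.aestronglyMeasurable]
    rw [h1, integral_prod _ hi, integral_map hW.aemeasurable hi'.aestronglyMeasurable]

end AveragedSGD

end

noncomputable section

namespace AveragedSGD

variable {E : Type*} [NormedAddCommGroup E] [InnerProductSpace ℝ E] [CompleteSpace E]
  [SecondCountableTopology E] [MeasurableSpace E] [BorelSpace E]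
  {Ω : Type*} [MeasurableSpace Ω] {P : Measure Ω} [IsProbabilityMeasure P]
  {D : Measure (E × ℝ)} [IsProbabilityMeasure D] {N : ℕ} {Z : ℕ → Ω → E × ℝ}
  {ζ : E × ℝ → ℝ} {H : E →L[ℝ] E} {α s : ℝ}

/-! ### Second moments of random vectors in an eigenbasis -/

/-- By nonnegativity the partial sums of the integrals stay below `∫ g`, which gives the absolute
summability needed for the exchange. -/
lemma hasSum_integral_of_nonneg {ι X : Type*} [Countable ι] [MeasurableSpace X] {μ : Measure X}
    {f : ι → X → ℝ} {g : X → ℝ} (hf0 : ∀ i x, 0 ≤ f i x) (hf : ∀ i, Integrable (f i) μ)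
    (hg : Integrable g μ) (hfg : ∀ x, HasSum (fun i => f i x) (g x)) :
    HasSum (fun i => ∫ x, f i x ∂μ) (∫ x, g x ∂μ) := by
  have hs : Summable fun i => ∫ x, ‖f i x‖ ∂μ := by
    simp only [fun i x => Real.norm_of_nonneg (hf0 i x)]
    refine summable_of_sum_le (c := ∫ x, g x ∂μ) (fun i => integral_nonneg (hf0 i)) fun F => ?_
    rw [← integral_finsetSum F fun i _ => hf i]
    exact integral_mono (integrable_finsetSum F fun i _ => hf i) hg
      fun x => sum_le_hasSum F (fun i _ => hf0 i x) (hfg x)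
  have h := hasSum_integral_of_summable_integral_norm hf hs
  simpa only [fun x => (hfg x).tsum_eq] using h

lemma integrable_inner_mul_inner {X Y : Ω → E} (hX : Measurable X) (hY : Measurable Y)
    (hX2 : Integrable (fun ω => ‖X ω‖ ^ 2) P) (hY2 : Integrable (fun ω => ‖Y ω‖ ^ 2) P) (u w : E) :
    Integrable (fun ω => inner ℝ u (X ω) * inner ℝ w (Y ω)) P := by
  have key : ∀ {X : Ω → E} (_ : Measurable X) (_ : Integrable (fun ω => ‖X ω‖ ^ 2) P) (u : E),
      Integrable (fun ω => inner ℝ u (X ω) ^ 2) P := by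
    intro X hX hX2 u
    refine (hX2.const_mul (‖u‖ ^ 2)).mono' (by fun_prop) (ae_of_all _ fun ω => ?_)
    rw [← mul_pow, Real.norm_of_nonneg (sq_nonneg _), ← sq_abs]
    gcongr
    exact abs_real_inner_le_norm _ _
  exact integrable_mul_of_sq (by fun_prop) (by fun_prop) (key hX hX2 u) (key hY hY2 w)

lemma integrable_inner_of_sq {X : Ω → E} (hX : Measurable X)
    (hX2 : Integrable (fun ω => ‖X ω‖ ^ 2) P) (u : E) :
    Integrable (fun ω => inner ℝ u (X ω)) P := by
  refine MemLp.integrable one_le_two ((memLp_two_iff_integrable_sq (by fun_prop)).2 ?_)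
  simpa only [sq] using integrable_inner_mul_inner hX hX hX2 hX2 u u

lemma integrable_inner_apply {X : Ω → E} (hX : Measurable X)
    (hX2 : Integrable (fun ω => ‖X ω‖ ^ 2) P) (T : E →L[ℝ] E) :
    Integrable (fun ω => inner ℝ (X ω) (T (X ω))) P := by
  refine (hX2.const_mul ‖T‖).mono' (by fun_prop) (ae_of_all _ fun ω => ?_)
  calc ‖(inner ℝ (X ω) (T (X ω)) : ℝ)‖ ≤ ‖X ω‖ * ‖T (X ω)‖ := norm_inner_le_norm _ _
    _ ≤ ‖X ω‖ * (‖T‖ * ‖X ω‖) := by gcongr; exact T.le_opNorm _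
    _ = ‖T‖ * ‖X ω‖ ^ 2 := by ring

/-- Parseval under the expectation. It serves for the risk (`T = H`) and, with all `lam i = 1`, for
the squared norm. -/
lemma hasSum_integral_inner_sq {ι : Type*} [Countable ι] (v : HilbertBasis ι ℝ E) {lam : ι → ℝ}
    {T : E →L[ℝ] E} (hT : ∀ i x, inner ℝ (v i) (T x) = lam i * inner ℝ (v i) x)
    (hlam : ∀ i, 0 ≤ lam i) {X : Ω → E}
    (hX : Measurable X) (hX2 : Integrable (fun ω => ‖X ω‖ ^ 2) P) :
    HasSum (fun i => lam i * ∫ ω, inner ℝ (v i) (X ω) ^ 2 ∂P)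
      (∫ ω, inner ℝ (X ω) (T (X ω)) ∂P) := by
  simp only [← integral_const_mul]
  refine hasSum_integral_of_nonneg (fun i ω => mul_nonneg (hlam i) (sq_nonneg _)) (fun i => ?_)
    (integrable_inner_apply hX hX2 T) fun ω => ?_
  · simpa only [sq] using (integrable_inner_mul_inner hX hX hX2 hX2 (v i) (v i)).const_mul (lam i)
  · have e : ∀ i, lam i * inner ℝ (v i) (X ω) ^ 2 =
        inner ℝ (X ω) (v i) * inner ℝ (v i) (T (X ω)) := fun i => by
      rw [hT, real_inner_comm (v i)]
      ring
    simpa only [e] using v.hasSum_inner_mul_inner (X ω) (T (X ω))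

/-! ### Moments of the error process -/

namespace NoiseModel

/-- In `norm_next_sq_le` the squared error multiplies a function of the fresh sample, integrable by
the fourth moment; a product of independent integrable variables is integrable. -/
lemma integrable_norm_err_sq (h : NoiseModel D H α s ζ) (hZ : Samples D P N Z) {γ : ℝ}
    (hγ : 0 ≤ γ) (u : E) {t : ℕ} (ht : t ≤ N) :
    Integrable (fun ω => ‖err γ u ζ Z t ω‖ ^ 2) P := by
  have hme := fun t => hZ.measurable_err h.measurable γ u t
  induction t with
  | zero => exact integrable_const (‖u‖ ^ 2)
  | succ t ih =>
    have hmZ := hZ.measurable (t + 1)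
    have hlaw := hZ.map_eq (t + 1) ⟨by omega, ht⟩
    have hmζ := h.measurable
    have tr : ∀ {g : E × ℝ → ℝ}, Integrable g D → Integrable (fun ω => g (Z (t + 1) ω)) P := by
      intro g hg
      rw [← hlaw] at hg
      exact hg.comp_measurable hmZ
    have hg : Integrable (fun z : E × ℝ => 2 * (1 + γ * ‖z.1‖ ^ 2) ^ 2) D := by
      have : Integrable (fun z : E × ℝ =>
          2 + 4 * γ * ‖z.1‖ ^ 2 + 2 * γ ^ 2 * ‖z.1‖ ^ 4) D :=
        ((integrable_const 2).add (h.integrable_two.const_mul (4 * γ))).add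
          (h.integrable_four.const_mul (2 * γ ^ 2))
      refine this.congr (ae_of_all _ fun z => ?_)
      simp only
      ring
    have hind : IndepFun (fun ω => ‖err γ u ζ Z t ω‖ ^ 2)
        (fun ω => 2 * (1 + γ * ‖(Z (t + 1) ω).1‖ ^ 2) ^ 2) P :=
      (hZ.indepFun_err h.measurable γ u le_rfl ht).comp
        (φ := fun p : E × E => ‖p.1‖ ^ 2) (ψ := fun z : E × ℝ => 2 * (1 + γ * ‖z.1‖ ^ 2) ^ 2)
        (by fun_prop) (by fun_prop)
    have h1 := hind.integrable_mul (ih (by omega)) (tr hg)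
    have h2 := (tr h.integrable_noise).const_mul (2 * γ ^ 2)
    have := hme (t + 1)
    refine (h1.add h2).mono' (by fun_prop) (ae_of_all _ fun ω => ?_)
    rw [Real.norm_of_nonneg (sq_nonneg _)]
    exact norm_next_sq_le hγ ζ _ _

/-- Independence of the sample `Z (k + 1)` from the errors up to time `k`, in integrated form. -/
lemma integral_mul_inner_err_succ (h : NoiseModel D H α s ζ) (hZ : Samples D P N Z) {γ : ℝ}
    (u : E) {t k : ℕ} (htk : t ≤ k) (hk : k < N) {f : E → ℝ} (hf : Measurable f)
    (w : E) (hint : Integrable (fun ω => f (err γ u ζ Z t ω) *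
      inner ℝ w (err γ u ζ Z (k + 1) ω)) P) :
    ∫ ω, f (err γ u ζ Z t ω) * inner ℝ w (err γ u ζ Z (k + 1) ω) ∂P =
      ∫ ω, f (err γ u ζ Z t ω) *
        (inner ℝ w (err γ u ζ Z k ω) - γ * inner ℝ w (H (err γ u ζ Z k ω))) ∂P := by
  have hme := fun t => hZ.measurable_err h.measurable γ u t
  have hnext := h.measurable_next γ
  have hmF : Measurable fun p : (E × E) × E × ℝ =>
      f p.1.1 * inner ℝ w (next γ ζ p.1.2 p.2) := by
    have h2 : Measurable fun p : (E × E) × E × ℝ => next γ ζ p.1.2 p.2 :=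
      hnext.comp ((measurable_snd.comp measurable_fst).prodMk measurable_snd)
    fun_prop
  have := (integral_eq_of_indepFun (f := fun (p : E × E) z => f p.1 * inner ℝ w (next γ ζ p.2 z))
    ((hme t).prodMk (hme k)) (hZ.measurable (k + 1)) (hZ.indepFun_err h.measurable γ u htk hk)
    (hZ.map_eq (k + 1) ⟨by omega, hk⟩) hmF hint).2
  simp only [integral_const_mul, h.integral_inner_next] at this
  exact this

/-- The mean evolves by `I - γH` and starts at `0`. The direction `w` must vary in the induction,
since `H` is moved onto it. -/
lemma integral_inner_err_eq_zero (h : NoiseModel D H α s ζ) (hZ : Samples D P N Z) {γ : ℝ}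
    (hγ : 0 ≤ γ) (hH : ∀ x y, inner ℝ x (H y) = inner ℝ (H x) y) {t : ℕ} (ht : t ≤ N) (w : E) :
    ∫ ω, inner ℝ w (err γ 0 ζ Z t ω) ∂P = 0 := by
  induction t generalizing w with
  | zero => simp [err, iterate]
  | succ t ih =>
    have hi : ∀ w t, t ≤ N → Integrable (fun ω => inner ℝ w (err γ 0 ζ Z t ω)) P := fun w t ht =>
      integrable_inner_of_sq (hZ.measurable_err h.measurable γ 0 t)
        (h.integrable_norm_err_sq hZ hγ 0 ht) w
    have := h.integral_mul_inner_err_succ hZ 0 le_rfl ht (f := fun _ => 1) measurable_const w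
      (by simpa only [one_mul] using hi w (t + 1) ht)
    simp only [one_mul, hH] at this
    rw [this, integral_sub (hi _ _ (by omega)) ((hi _ _ (by omega)).const_mul γ),
      integral_const_mul, ih (by omega), ih (by omega)]
    simp

/-- Each later step multiplies the conditional mean along the eigenvector `w` by `1 - γ * l`. -/
lemma integral_inner_err_mul (h : NoiseModel D H α s ζ) (hZ : Samples D P N Z) {γ l : ℝ}
    (hγ : 0 ≤ γ) (u : E) {w : E} (hw : ∀ x, inner ℝ w (H x) = l * inner ℝ w x) {t k : ℕ}
    (htk : t ≤ k) (hk : k ≤ N) :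
    ∫ ω, inner ℝ w (err γ u ζ Z t ω) * inner ℝ w (err γ u ζ Z k ω) ∂P =
      (1 - γ * l) ^ (k - t) * ∫ ω, inner ℝ w (err γ u ζ Z t ω) ^ 2 ∂P := by
  induction k, htk using Nat.le_induction with
  | base => simp [sq]
  | succ k htk ih =>
    have hme := fun t => hZ.measurable_err h.measurable γ u t
    have hi := integrable_inner_mul_inner (hme t) (hme (k + 1))
      (h.integrable_norm_err_sq hZ hγ u (by omega)) (h.integrable_norm_err_sq hZ hγ u hk) w w
    rw [h.integral_mul_inner_err_succ hZ u htk hk (f := fun x => inner ℝ w x) (by fun_prop) w hi,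
      Nat.succ_sub htk, pow_succ', mul_assoc, ← ih (by omega), ← integral_const_mul]
    refine integral_congr_ae (ae_of_all _ fun ω => ?_)
    simp only [hw]
    ring

/-- The alternative `hu` disposes of the cross term: either the error has mean zero, or there is no
noise. This is why bias and variance are run separately. -/
lemma integral_inner_err_succ_sq_le (h : NoiseModel D H α s ζ) (hZ : Samples D P N Z) {γ l : ℝ}
    (hγ : 0 ≤ γ) (u : E) (hH : ∀ x y, inner ℝ x (H y) = inner ℝ (H x) y)
    (hu : u = 0 ∨ ∀ z, ζ z = 0) {w : E} (hw1 : ‖w‖ = 1)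
    (hw : ∀ x, inner ℝ w (H x) = l * inner ℝ w x) {t : ℕ} (ht : t < N) :
    ∫ ω, inner ℝ w (err γ u ζ Z (t + 1) ω) ^ 2 ∂P ≤
      (1 - 2 * γ * l) * ∫ ω, inner ℝ w (err γ u ζ Z t ω) ^ 2 ∂P +
        γ ^ 2 * l * (α * ∫ ω, inner ℝ (err γ u ζ Z t ω) (H (err γ u ζ Z t ω)) ∂P + s) := by
  have hme := fun t => hZ.measurable_err h.measurable γ u t
  have hsq : ∀ t ≤ N, Integrable (fun ω => inner ℝ w (err γ u ζ Z t ω) ^ 2) P := fun t ht => by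
    simpa only [sq] using integrable_inner_mul_inner (hme t) (hme t)
      (h.integrable_norm_err_sq hZ hγ u ht) (h.integrable_norm_err_sq hZ hγ u ht) w w
  have hmF : Measurable fun p : (E × E) × E × ℝ => inner ℝ w (next γ ζ p.1.2 p.2) ^ 2 := by
    have h2 : Measurable fun p : (E × E) × E × ℝ => next γ ζ p.1.2 p.2 :=
      (h.measurable_next γ).comp ((measurable_snd.comp measurable_fst).prodMk measurable_snd)
    fun_prop
  obtain ⟨hi, heq⟩ := integral_eq_of_indepFun
    (f := fun (p : E × E) z => inner ℝ w (next γ ζ p.2 z) ^ 2)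
    ((hme t).prodMk (hme t)) (hZ.measurable (t + 1))
    (hZ.indepFun_err h.measurable γ u le_rfl ht)
    (hZ.map_eq (t + 1) ⟨by omega, ht⟩) hmF (hsq (t + 1) ht)
  have hcross : ∫ ω, inner ℝ (mixedMoment D ζ w) (err γ u ζ Z t ω) ∂P = 0 := by
    rcases hu with rfl | hζ
    · exact h.integral_inner_err_eq_zero hZ hγ hH ht.le _
    · simp [mixedMoment, hζ]
  have i1 := (hsq t ht.le).const_mul (1 - 2 * γ * l)
  have i2 := integrable_inner_apply (hme t) (h.integrable_norm_err_sq hZ hγ u ht.le) H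
  have i3 : Integrable (fun ω => γ ^ 2 * l *
      (α * inner ℝ (err γ u ζ Z t ω) (H (err γ u ζ Z t ω)) + s)) P :=
    ((i2.const_mul α).add (integrable_const s)).const_mul _
  have i4 := (integrable_inner_of_sq (hme t) (h.integrable_norm_err_sq hZ hγ u ht.le)
    (mixedMoment D ζ w)).const_mul (2 * γ ^ 2)
  have i13 : Integrable (fun ω => (1 - 2 * γ * l) * inner ℝ w (err γ u ζ Z t ω) ^ 2 + γ ^ 2 * l *
      (α * inner ℝ (err γ u ζ Z t ω) (H (err γ u ζ Z t ω)) + s)) P := i1.add i3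
  have hle : ∀ ω, ∫ z, inner ℝ w (next γ ζ (err γ u ζ Z t ω) z) ^ 2 ∂D ≤
      (1 - 2 * γ * l) * inner ℝ w (err γ u ζ Z t ω) ^ 2 + γ ^ 2 * l *
        (α * inner ℝ (err γ u ζ Z t ω) (H (err γ u ζ Z t ω)) + s) -
        2 * γ ^ 2 * inner ℝ (mixedMoment D ζ w) (err γ u ζ Z t ω) := by
    intro ω
    have := h.integral_inner_next_sq_le γ w (err γ u ζ Z t ω)
    rw [hw, hw, real_inner_self_eq_norm_sq, hw1, real_inner_comm (mixedMoment D ζ w)] at this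
    linarith
  refine heq.trans_le ((integral_mono hi (i13.sub i4) hle).trans_eq ?_)
  refine (integral_sub i13 i4).trans ?_
  rw [integral_add i1 i3, integral_const_mul, integral_const_mul, integral_const_mul,
    integral_add (i2.const_mul α) (integrable_const s), integral_const_mul, hcross]
  simp

lemma integral_sum_err_succ_sq (h : NoiseModel D H α s ζ) (hZ : Samples D P N Z) {γ l : ℝ}
    (hγ : 0 ≤ γ) (u : E) {w : E} (hw : ∀ x, inner ℝ w (H x) = l * inner ℝ w x) {n : ℕ}
    (hn : n < N) :
    ∫ ω, (∑ t ∈ Finset.range (n + 1), inner ℝ w (err γ u ζ Z t ω)) ^ 2 ∂P =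
      ∫ ω, (∑ t ∈ Finset.range n, inner ℝ w (err γ u ζ Z t ω)) ^ 2 ∂P +
        2 * ∑ t ∈ Finset.range n, (1 - γ * l) ^ (n - t) *
          ∫ ω, inner ℝ w (err γ u ζ Z t ω) ^ 2 ∂P +
        ∫ ω, inner ℝ w (err γ u ζ Z n ω) ^ 2 ∂P := by
  have hi : ∀ t k, t ≤ N → k ≤ N → Integrable (fun ω =>
      inner ℝ w (err γ u ζ Z t ω) * inner ℝ w (err γ u ζ Z k ω)) P := fun t k ht hk =>
    integrable_inner_mul_inner (hZ.measurable_err h.measurable γ u t)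
      (hZ.measurable_err h.measurable γ u k) (h.integrable_norm_err_sq hZ hγ u ht)
      (h.integrable_norm_err_sq hZ hγ u hk) w w
  have i1 : Integrable (fun ω =>
      (∑ t ∈ Finset.range n, inner ℝ w (err γ u ζ Z t ω)) ^ 2) P := by
    simp only [sq, Finset.sum_mul_sum]
    refine integrable_finsetSum _ fun t ht => integrable_finsetSum _ fun k hk => ?_
    rw [Finset.mem_range] at ht hk
    exact hi t k (by omega) (by omega)
  have i2' : ∀ t ∈ Finset.range n, Integrable (fun ω =>
      inner ℝ w (err γ u ζ Z t ω) * inner ℝ w (err γ u ζ Z n ω)) P := fun t ht => by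
    rw [Finset.mem_range] at ht
    exact hi t n (by omega) (by omega)
  have i2 : Integrable (fun ω => 2 * ∑ t ∈ Finset.range n,
      inner ℝ w (err γ u ζ Z t ω) * inner ℝ w (err γ u ζ Z n ω)) P :=
    (integrable_finsetSum _ i2').const_mul 2
  have i3 : Integrable (fun ω => inner ℝ w (err γ u ζ Z n ω) ^ 2) P := by
    simpa only [sq] using hi n n hn.le hn.le
  have i12 : Integrable (fun ω => (∑ t ∈ Finset.range n, inner ℝ w (err γ u ζ Z t ω)) ^ 2 +
    2 * ∑ t ∈ Finset.range n, inner ℝ w (err γ u ζ Z t ω) * inner ℝ w (err γ u ζ Z n ω)) P :=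
    i1.add i2
  have e : ∀ ω, (∑ t ∈ Finset.range (n + 1), inner ℝ w (err γ u ζ Z t ω)) ^ 2 =
      (∑ t ∈ Finset.range n, inner ℝ w (err γ u ζ Z t ω)) ^ 2 +
      2 * ∑ t ∈ Finset.range n, inner ℝ w (err γ u ζ Z t ω) * inner ℝ w (err γ u ζ Z n ω) +
      inner ℝ w (err γ u ζ Z n ω) ^ 2 := fun ω => by
    rw [Finset.sum_range_succ, ← Finset.sum_mul]
    ring
  simp only [e]
  rw [integral_add i12 i3, integral_add i1 i2, integral_const_mul, integral_finsetSum _ i2',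
    Finset.sum_congr rfl fun t ht =>
      h.integral_inner_err_mul hZ hγ u hw (Finset.mem_range.1 ht).le hn.le]

end NoiseModel

end AveragedSGD

end

noncomputable section

namespace AveragedSGD

variable {E : Type*} [NormedAddCommGroup E] [InnerProductSpace ℝ E] [CompleteSpace E]
  [SecondCountableTopology E] [MeasurableSpace E] [BorelSpace E]
  {Ω : Type*} [MeasurableSpace Ω] {P : Measure Ω} [IsProbabilityMeasure P]
  {D : Measure (E × ℝ)} [IsProbabilityMeasure D] {N : ℕ} {Z : ℕ → Ω → E × ℝ}
  {ζ : E × ℝ → ℝ} {H : E →L[ℝ] E} {α s : ℝ}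

/-! ### Spectral sums -/

section SpectralSums

variable {d : ℕ∞} {lam : BasisIndex d → ℝ}

lemma finite_setOf_index_le (d : ℕ∞) (k : ℕ) : {i : BasisIndex d | (i : ℕ) ≤ k}.Finite :=
  (Set.finite_Iic k).preimage Subtype.val_injective.injOn

lemma summable_head (k : ℕ) (f : BasisIndex d → ℝ) :
    Summable fun i : BasisIndex d => if (i : ℕ) ≤ k then f i else 0 :=
  summable_of_hasFiniteSupport ((finite_setOf_index_le d k).subset fun i hi => by
    by_contra h
    exact hi (if_neg h))

/-- Indices start at `1`, so at most `k` of them are `≤ k`; fewer if `d < k`. -/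
lemma tsum_head_const_le (d : ℕ∞) (k : ℕ) {c : ℝ} (hc : 0 ≤ c) :
    ∑' i : BasisIndex d, (if (i : ℕ) ≤ k then c else 0) ≤ k * c := by
  set F := (finite_setOf_index_le d k).toFinset
  have hF : ∀ i : BasisIndex d, i ∈ F ↔ (i : ℕ) ≤ k := fun i => by simp [F]
  rw [tsum_eq_sum (s := F) fun i hi => if_neg fun h => hi ((hF i).2 h),
    Finset.sum_congr rfl fun i hi => if_pos ((hF i).1 hi), Finset.sum_const, nsmul_eq_mul]
  have hcard : F.card ≤ k :=
    (Finset.card_le_card_of_injOn (s := F) (t := Finset.Icc 1 k) (fun i => (i : ℕ))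
      (fun i hi => Finset.mem_coe.2 (Finset.mem_Icc.2 ⟨i.2.1, (hF i).1 hi⟩))
      Subtype.val_injective.injOn).trans_eq (Nat.card_Icc 1 k)
  gcongr

lemma summable_tail (k : ℕ) {f : BasisIndex d → ℝ} (hf : Summable f) :
    Summable fun i : BasisIndex d => if k < (i : ℕ) then f i else 0 :=
  (hf.indicator {i : BasisIndex d | k < (i : ℕ)}).congr fun i => by simp [Set.indicator_apply]

lemma summable_sq_of_mul_le_one {γ : ℝ} (hγ : 0 < γ) (hlam : ∀ i, 0 < lam i)
    (hγl : ∀ i, γ * lam i ≤ 1) (hsum : Summable lam) : Summable fun i => lam i ^ 2 := by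
  refine Summable.of_nonneg_of_le (fun i => sq_nonneg _) (fun i => ?_) (hsum.div_const γ)
  rw [le_div_iff₀ hγ]
  nlinarith [hγl i, hlam i]

lemma hasSum_inner_sq (v : HilbertBasis (BasisIndex d) ℝ E) (u : E) :
    HasSum (fun i => inner ℝ (v i) u ^ 2) (‖u‖ ^ 2) := by
  simpa only [real_inner_comm, ← sq, real_inner_self_eq_norm_sq] using
    v.hasSum_inner_mul_inner u u

lemma tailSqSum_nonneg (lam : BasisIndex d → ℝ) (k : ℕ) : 0 ≤ tailSqSum lam k :=
  tsum_nonneg fun i => by split_ifs <;> positivity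

end SpectralSums

/-! ### Risk of the averaged errors and bounds on the accumulated gradient noise -/

namespace NoiseModel

variable {d : ℕ∞} {v : HilbertBasis (BasisIndex d) ℝ E} {lam : BasisIndex d → ℝ} {γ : ℝ}

/-- Excess risk of the averaged errors, given a bound `K` on the accumulated gradient noise. -/
lemma integral_average_le (h : NoiseModel D H α s ζ) (hZ : Samples D P N Z) (hN : 0 < N)
    (hγ : 0 < γ) {u : E} (hH : ∀ x y, inner ℝ x (H y) = inner ℝ (H x) y)
    (hv : ∀ i x, inner ℝ (v i) (H x) = lam i * inner ℝ (v i) x) (hlam : ∀ i, 0 < lam i)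
    (hγl : ∀ i, γ * lam i ≤ 1) (hsum : Summable lam) (hu : u = 0 ∨ ∀ z, ζ z = 0)
    {K : ℝ} (hK0 : 0 ≤ K)
    (hK : ∀ n ≤ N, ∑ t ∈ Finset.range n,
      (α * ∫ ω, inner ℝ (err γ u ζ Z t ω) (H (err γ u ζ Z t ω)) ∂P + s) ≤ K) (k : ℕ)
    {X : Ω → E} (hX : Measurable X) (hX2 : Integrable (fun ω => ‖X ω‖ ^ 2) P)
    (hXe : ∀ ω, X ω = (1 / (N : ℝ)) • ∑ t ∈ Finset.range N, err γ u ζ Z t ω) :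
    ∫ ω, inner ℝ (X ω) (H (X ω)) ∂P ≤
      2 * (effectiveBias v lam γ N k u + K * (k / (N : ℝ) ^ 2 + γ ^ 2 * tailSqSum lam k)) := by
  have hN' : (0 : ℝ) < N := by exact_mod_cast hN
  set V : BasisIndex d → ℕ → ℝ := fun i n =>
    ∫ ω, (∑ t ∈ Finset.range n, inner ℝ (v i) (err γ u ζ Z t ω)) ^ 2 ∂P with hVdef
  have hcoord : ∀ i, ∫ ω, inner ℝ (v i) (X ω) ^ 2 ∂P = V i N / (N : ℝ) ^ 2 := by
    intro i
    rw [hVdef, div_eq_inv_mul, ← integral_const_mul]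
    refine integral_congr_ae (ae_of_all _ fun ω => ?_)
    simp only [hXe, inner_smul_right, inner_sum, mul_pow]
    rw [one_div, inv_pow]
  have hle : ∀ i, lam i * ∫ ω, inner ℝ (v i) (X ω) ^ 2 ∂P ≤
      2 * (1 / (γ ^ 2 * (N : ℝ) ^ 2) *
          (if (i : ℕ) ≤ k then inner ℝ (v i) u ^ 2 / lam i else 0) +
        (if k < (i : ℕ) then lam i * inner ℝ (v i) u ^ 2 else 0) +
        ((if (i : ℕ) ≤ k then K / (N : ℝ) ^ 2 else 0) +
          γ ^ 2 * K * (if k < (i : ℕ) then lam i ^ 2 else 0))) := by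
    intro i
    rw [hcoord i]
    have key := eigenvalue_mul_le (m := fun t =>
        α * ∫ ω, inner ℝ (err γ u ζ Z t ω) (H (err γ u ζ Z t ω)) ∂P + s)
      (b := fun t => ∫ ω, inner ℝ (v i) (err γ u ζ Z t ω) ^ 2 ∂P) (V := V i)
      (u := inner ℝ (v i) u ^ 2) hN hγ (hlam i) (hγl i) hK0
      (fun t => integral_nonneg fun ω => sq_nonneg _) (by simp [err, iterate]) hK
      (fun t ht => ?_) (by simp [hVdef])
      (fun n hn => h.integral_sum_err_succ_sq hZ hγ.le u (hv i) hn)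
    -- Both estimates hold for every eigenvalue, so the cutoff `k` merely selects one of them.
    · rcases le_or_gt (i : ℕ) k with hik | hik
      · simpa [hik, not_lt.2 hik] using key.1
      · simpa [hik, not_le.2 hik] using key.2
    · refine (h.integral_inner_err_succ_sq_le hZ hγ.le u hH hu (v.orthonormal.1 i) (hv i)
        ht).trans ?_
      -- Adding this term completes `1 - 2γλ` to `(1 - γλ)²`.
      have : 0 ≤ (γ * lam i) ^ 2 * ∫ ω, inner ℝ (v i) (err γ u ζ Z t ω) ^ 2 ∂P :=
        mul_nonneg (sq_nonneg _) (integral_nonneg fun ω => sq_nonneg _)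
      linarith
  have s1 := summable_head k fun i => inner ℝ (v i) u ^ 2 / lam i
  have s2 : Summable fun i => lam i * inner ℝ (v i) u ^ 2 := by
    refine Summable.of_nonneg_of_le (fun i => mul_nonneg (hlam i).le (sq_nonneg _)) (fun i => ?_)
      ((hasSum_inner_sq v u).summable.div_const γ)
    rw [le_div_iff₀ hγ]
    nlinarith [mul_le_mul_of_nonneg_right (hγl i) (sq_nonneg (inner ℝ (v i) u))]
  have s3 := summable_head (d := d) k fun _ => K / (N : ℝ) ^ 2
  have s4 := summable_tail k (summable_sq_of_mul_le_one hγ hlam hγl hsum)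
  have hlhs := hasSum_integral_inner_sq v hv (fun i => (hlam i).le) hX hX2
  have hrhs := (((s1.hasSum.mul_left (1 / (γ ^ 2 * (N : ℝ) ^ 2))).add
    (summable_tail k s2).hasSum).add
      (s3.hasSum.add (s4.hasSum.mul_left (γ ^ 2 * K)))).mul_left 2
  refine (hasSum_le hle hlhs hrhs).trans ?_
  have hcard := tsum_head_const_le d k (c := K / (N : ℝ) ^ 2) (by positivity)
  rw [effectiveBias, headInvNormSq, tailNormSq, tailSqSum]
  have e : (k : ℝ) * (K / (N : ℝ) ^ 2) = K * (k / (N : ℝ) ^ 2) := by ring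
  rw [e] at hcard
  linarith

/-- Without noise, the accumulated risk of the iterates is controlled by the initial distance. -/
lemma sum_integral_le_of_noiseless (h : NoiseModel D H α 0 ζ) (hZ : Samples D P N Z)
    (hγ : 0 < γ) {u : E} (hH : ∀ x y, inner ℝ x (H y) = inner ℝ (H x) y)
    (hv : ∀ i x, inner ℝ (v i) (H x) = lam i * inner ℝ (v i) x) (hlam : ∀ i, 0 < lam i)
    {τ : ℝ} (hsum : HasSum lam τ) (hτ : γ * α * τ ≤ 1) (hζ : ∀ z, ζ z = 0) {n : ℕ} (hn : n ≤ N) :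
    γ * ∑ t ∈ Finset.range n, ∫ ω, inner ℝ (err γ u ζ Z t ω) (H (err γ u ζ Z t ω)) ∂P ≤
      ‖u‖ ^ 2 := by
  have hme := fun t => hZ.measurable_err h.measurable γ u t
  have hi : ∀ t ≤ N, Integrable (fun ω => ‖err γ u ζ Z t ω‖ ^ 2) P := fun t ht =>
    h.integrable_norm_err_sq hZ hγ.le u ht
  set r : ℕ → ℝ := fun t => ∫ ω, inner ℝ (err γ u ζ Z t ω) (H (err γ u ζ Z t ω)) ∂P with hr
  have hsq : ∀ t ≤ N, HasSum (fun i => ∫ ω, inner ℝ (v i) (err γ u ζ Z t ω) ^ 2 ∂P)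
      (∫ ω, ‖err γ u ζ Z t ω‖ ^ 2 ∂P) := fun t ht => by
    simpa using hasSum_integral_inner_sq v (lam := fun _ => 1) (T := ContinuousLinearMap.id ℝ E)
      (by simp) (by simp) (hme t) (hi t ht)
  have hh : ∀ t ≤ N, HasSum (fun i => lam i * ∫ ω, inner ℝ (v i) (err γ u ζ Z t ω) ^ 2 ∂P)
      (r t) := fun t ht =>
    hasSum_integral_inner_sq v hv (fun i => (hlam i).le) (hme t) (hi t ht)
  have hr0 : ∀ t ≤ N, 0 ≤ r t := fun t ht => (hh t ht).nonneg fun i =>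
    mul_nonneg (hlam i).le (integral_nonneg fun ω => sq_nonneg _)
  -- Summed over the eigenbasis, the one-step bound loses `2γ r t` and gains `γ²ατ r t`, which is at
  -- most `γ r t` by the stepsize condition.
  have hstep : ∀ t < N, ∫ ω, ‖err γ u ζ Z (t + 1) ω‖ ^ 2 ∂P ≤
      ∫ ω, ‖err γ u ζ Z t ω‖ ^ 2 ∂P - γ * r t := by
    intro t ht
    have hle := hasSum_le (fun i => (h.integral_inner_err_succ_sq_le hZ hγ.le u hH (Or.inr hζ)
      (v.orthonormal.1 i) (hv i) ht).trans_eq (show _ =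
        ∫ ω, inner ℝ (v i) (err γ u ζ Z t ω) ^ 2 ∂P -
        2 * γ * (lam i * ∫ ω, inner ℝ (v i) (err γ u ζ Z t ω) ^ 2 ∂P) +
        γ ^ 2 * α * r t * lam i by simp only [hr]; ring)) (hsq (t + 1) ht)
      (((hsq t ht.le).sub ((hh t ht.le).mul_left (2 * γ))).add
        (hsum.mul_left (γ ^ 2 * α * r t)))
    have := mul_le_mul_of_nonneg_right hτ (mul_nonneg hγ.le (hr0 t ht.le))
    linarith
  have key : ∀ n ≤ N, γ * ∑ t ∈ Finset.range n, r t ≤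
      ‖u‖ ^ 2 - ∫ ω, ‖err γ u ζ Z n ω‖ ^ 2 ∂P := by
    intro n
    induction n with
    | zero => simp [err, iterate]
    | succ n ih =>
      intro hn
      rw [Finset.sum_range_succ]
      linarith [ih (by omega), hstep n hn]
  exact (key n hn).trans (sub_le_self _ (integral_nonneg fun ω => sq_nonneg _))

/-- Started at the optimum, the iterates have uniformly bounded risk. -/
lemma integral_le_of_start_zero (h : NoiseModel D H α s ζ) (hZ : Samples D P N Z)
    (hγ : 0 < γ) (hα : 0 ≤ α) (hH : ∀ x y, inner ℝ x (H y) = inner ℝ (H x) y)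
    (hv : ∀ i x, inner ℝ (v i) (H x) = lam i * inner ℝ (v i) x) (hlam : ∀ i, 0 < lam i)
    (hγl : ∀ i, γ * lam i ≤ 1) {τ c : ℝ} (hsum : HasSum lam τ) (hc0 : 0 ≤ c)
    (hc : γ * (α * (c * τ) + s) ≤ c) {t : ℕ} (ht : t ≤ N) :
    ∫ ω, inner ℝ (err γ 0 ζ Z t ω) (H (err γ 0 ζ Z t ω)) ∂P ≤ c * τ := by
  have hh : ∀ t ≤ N, HasSum (fun i => lam i * ∫ ω, inner ℝ (v i) (err γ 0 ζ Z t ω) ^ 2 ∂P)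
      (∫ ω, inner ℝ (err γ 0 ζ Z t ω) (H (err γ 0 ζ Z t ω)) ∂P) := fun t ht =>
    hasSum_integral_inner_sq v hv (fun i => (hlam i).le) (hZ.measurable_err h.measurable γ 0 t)
      (h.integrable_norm_err_sq hZ hγ.le 0 ht)
  have hle : ∀ t ≤ N, (∀ i, ∫ ω, inner ℝ (v i) (err γ 0 ζ Z t ω) ^ 2 ∂P ≤ c) →
      ∫ ω, inner ℝ (err γ 0 ζ Z t ω) (H (err γ 0 ζ Z t ω)) ∂P ≤ c * τ := fun t ht hb =>
    hasSum_le (fun i => (mul_le_mul_of_nonneg_left (hb i) (hlam i).le).trans_eq (mul_comm _ _))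
      (hh t ht) (hsum.mul_left c)
  refine hle t ht fun i => ?_
  induction t generalizing i with
  | zero => simpa [err, iterate] using hc0
  | succ t ih =>
    -- With `x = γ * lam i`, the new second moment is at most `(1 - x)² c + x c = c - c x (1 - x)`,
    -- hence at most `c`.
    have hb := ih (by omega)
    have h1 := h.integral_inner_err_succ_sq_le hZ hγ.le 0 hH (Or.inl rfl)
      (v.orthonormal.1 i) (hv i) ht
    have hb0 : 0 ≤ ∫ ω, inner ℝ (v i) (err γ 0 ζ Z t ω) ^ 2 ∂P :=
      integral_nonneg fun ω => sq_nonneg _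
    have hx0 : 0 < γ * lam i := mul_pos hγ (hlam i)
    have h2 := mul_le_mul_of_nonneg_left (hle t (by omega) hb) hα
    have h3 := mul_le_mul_of_nonneg_left (add_le_add_left h2 s) (mul_pos hγ hx0).le
    have h4 := mul_le_mul_of_nonneg_left hc hx0.le
    have h5 := mul_le_mul_of_nonneg_left (hb i) (sq_nonneg (1 - γ * lam i))
    have h6 : 0 ≤ (γ * lam i) ^ 2 * ∫ ω, inner ℝ (v i) (err γ 0 ζ Z t ω) ^ 2 ∂P := by positivity
    have h7 : 0 ≤ c * (γ * lam i * (1 - γ * lam i)) :=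
      mul_nonneg hc0 (mul_nonneg hx0.le (sub_nonneg.2 (hγl i)))
    linarith

end NoiseModel

end AveragedSGD

end

noncomputable section

namespace AveragedSGD

variable {E : Type*} [NormedAddCommGroup E] [InnerProductSpace ℝ E] [CompleteSpace E]
  [SecondCountableTopology E] [MeasurableSpace E] [BorelSpace E]
  {Ω : Type*} [MeasurableSpace Ω] {P : Measure Ω} [IsProbabilityMeasure P]
  {D : Measure (E × ℝ)} [IsProbabilityMeasure D] {N : ℕ} {Z : ℕ → Ω → E × ℝ}
  {ζ : E × ℝ → ℝ} {H : E →L[ℝ] E} {α s : ℝ}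

/-! ### The bias-variance decomposition -/

/-- Writing `y = ⟨w⋆, x⟩ + ξ` makes the error a linear recursion with forcing `ξ`; superposition
separates the start from the forcing. -/
lemma iterate_sub_eq_err_add_err (γ : ℝ) (w₀ wStar : E) (Z : ℕ → Ω → E × ℝ) (t : ℕ) (ω : Ω) :
    iterate γ w₀ (fun r => Z r ω) t - wStar = err γ (w₀ - wStar) (fun _ => 0) Z t ω +
      err γ 0 (fun z => z.2 - inner ℝ wStar z.1) Z t ω := by
  induction t with
  | zero => simp [err, iterate]
  | succ t ih =>
    rw [err_succ, err_succ, next, next, iterate]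
    have e : iterate γ w₀ (fun r => Z r ω) t = wStar + (err γ (w₀ - wStar) (fun _ => 0) Z t ω +
        err γ 0 (fun z => z.2 - inner ℝ wStar z.1) Z t ω) := by rw [← ih]; abel
    rw [e]
    simp only [inner_add_left]
    module

lemma average_sub_eq (γ : ℝ) (w₀ wStar : E) (hN : 0 < N) (Z : ℕ → Ω → E × ℝ) (ω : Ω) :
    average γ w₀ N (fun r => Z r ω) - wStar =
      (1 / (N : ℝ)) • ∑ t ∈ Finset.range N, err γ (w₀ - wStar) (fun _ => 0) Z t ω +
        (1 / (N : ℝ)) • ∑ t ∈ Finset.range N,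
          err γ 0 (fun z => z.2 - inner ℝ wStar z.1) Z t ω := by
  have hN' : (N : ℝ) ≠ 0 := by exact_mod_cast hN.ne'
  rw [← smul_add, ← Finset.sum_add_distrib]
  simp only [← iterate_sub_eq_err_add_err]
  rw [Finset.sum_sub_distrib, smul_sub, average, Finset.sum_const, Finset.card_range,
    ← Nat.cast_smul_eq_nsmul ℝ, smul_smul, one_div, inv_mul_cancel₀ hN', one_smul]

lemma average_congr {γ : ℝ} {w₀ : E} {z z' : ℕ → E × ℝ}
    (h : ∀ t ∈ Set.Icc 1 N, z t = z' t) : average γ w₀ N z = average γ w₀ N z' := by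
  rw [average, average, Finset.sum_congr rfl fun t ht => iterate_congr fun r h1 h2 =>
    h r ⟨h1, h2.trans (Finset.mem_range.1 ht).le⟩]

/-- Expand the nonnegative form at `a - b`. -/
lemma inner_add_apply_add_le {T : E →L[ℝ] E} (hT : ∀ x, 0 ≤ inner ℝ x (T x)) (a b : E) :
    inner ℝ (a + b) (T (a + b)) ≤ 2 * inner ℝ a (T a) + 2 * inner ℝ b (T b) := by
  have h := hT (a - b)
  simp only [map_add, map_sub, inner_add_left, inner_add_right, inner_sub_left,
    inner_sub_right] at h ⊢
  linarith

lemma integrable_norm_smul_sum_sq {F : ℕ → Ω → E} (hF : ∀ t, Measurable (F t))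
    (hF2 : ∀ t < N, Integrable (fun ω => ‖F t ω‖ ^ 2) P) (c : ℝ) :
    Integrable (fun ω => ‖c • ∑ t ∈ Finset.range N, F t ω‖ ^ 2) P := by
  have : MemLp (fun ω => c • ∑ t ∈ Finset.range N, F t ω) 2 P :=
    (memLp_finsetSum (Finset.range N) fun t ht =>
      (memLp_two_iff_integrable_sq_norm (hF t).aestronglyMeasurable).2
        (hF2 t (Finset.mem_range.1 ht))).const_smul c
  exact (memLp_two_iff_integrable_sq_norm this.1).1 this

/-! ### Verification of the moment conditions -/

section Moments

variable {d : ℕ∞} {v : HilbertBasis (BasisIndex d) ℝ E} {wStar : E}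

lemma Regularity.inner_nonneg (hreg : Regularity D v wStar) (x : E) :
    0 ≤ inner ℝ x (secondMoment D x) := by
  rcases eq_or_ne x 0 with rfl | hx
  · simp
  · exact (hreg.posDef x hx).le

lemma Regularity.risk_le (hreg : Regularity D v wStar) (w : E) : risk D wStar ≤ risk D w := by
  rcases eq_or_ne w wStar with rfl | hw
  · exact le_rfl
  · exact (hreg.unique_min w hw).le

lemma noiseModel_residual {S : E →L[ℝ] E} (hreg : Regularity D v wStar)
    (hfourth : FourthMomentBound D v α) (hnoise : NoiseCondition D wStar S) :
    NoiseModel D (secondMoment D) α ‖S‖ (fun z => z.2 - inner ℝ wStar z.1) where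
  measurable := by fun_prop
  integrable_two := hreg.memLp_two_x.integrable_norm_pow two_ne_zero
  integrable_four := hreg.memLp_four_x.integrable_norm_pow (p := 4) four_ne_zero
  integrable_noise := hnoise.integrable_mul
  second := integral_inner_mul_inner hreg.memLp_two_x
  fourth := hfourth.integral_le hreg.memLp_four_x
  centered := integral_residual_mul_inner_eq_zero hreg.memLp_two_x hreg.memLp_two_y hreg.risk_le
  noise := hnoise.integral_le

lemma noiseModel_zero (hreg : Regularity D v wStar) (hfourth : FourthMomentBound D v α) :
    NoiseModel D (secondMoment D) α 0 (fun _ => 0) where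
  measurable := measurable_const
  integrable_two := hreg.memLp_two_x.integrable_norm_pow two_ne_zero
  integrable_four := hreg.memLp_four_x.integrable_norm_pow (p := 4) four_ne_zero
  integrable_noise := by simp
  second := integral_inner_mul_inner hreg.memLp_two_x
  fourth := hfourth.integral_le hreg.memLp_four_x
  centered := by simp
  noise := by simp

/-- The variance of `⟨w, x⟩²` is nonnegative, while the fourth moment condition bounds its second
moment by `α` times its squared mean. With `γ α tr H ≤ 1` this yields `γ λ ≤ 1`. -/
lemma NoiseModel.one_le (h : NoiseModel D H α s ζ) {w : E} (hw : 0 < inner ℝ w (H w)) :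
    1 ≤ α := by
  have h1 := h.memLp_inner_mul_inner w w
  have h2 := variance_nonneg (fun z : E × ℝ => inner ℝ w z.1 * inner ℝ z.1 w) D
  rw [variance_eq_sub h1, h.second] at h2
  have h3 := h.fourth w w
  have e : ∫ z, ((fun z : E × ℝ => inner ℝ w z.1 * inner ℝ z.1 w) ^ 2) z ∂D =
      ∫ z, inner ℝ z.1 w ^ 2 * inner ℝ z.1 w ^ 2 ∂D := by
    refine integral_congr_ae (ae_of_all _ fun z => ?_)
    simp only [Pi.pow_apply, real_inner_comm z.1 w]
    ring
  rw [e] at h2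
  by_contra hα
  nlinarith [mul_pos hw hw]

end Moments

/-- A law only provides a.e. measurability; measurable versions leave the averaged iterate a.e.
unchanged. -/
lemma Samples.of_hasLaw {Z : ℕ → Ω → E × ℝ} (hlaw : ∀ t ∈ Set.Icc 1 N, HasLaw (Z t) D P)
    (hindep : iIndepFun (fun t : Set.Icc 1 N => Z t) P) :
    ∃ Z', Samples D P N Z' ∧ ∀ t ∈ Set.Icc 1 N, Z t =ᵐ[P] Z' t := by
  classical
  let Z' : ℕ → Ω → E × ℝ := fun t =>
    if h : t ∈ Set.Icc 1 N then (hlaw t h).aemeasurable.mk (Z t) else fun _ => 0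
  have hae : ∀ t ∈ Set.Icc 1 N, Z t =ᵐ[P] Z' t := fun t ht => by
    simp only [Z', ht, dite_true]
    exact (hlaw t ht).aemeasurable.ae_eq_mk
  refine ⟨Z', ⟨fun t => ?_, fun t ht => ?_, ?_⟩, hae⟩
  · by_cases h : t ∈ Set.Icc 1 N
    · simp only [Z', h, dite_true]
      exact (hlaw t h).aemeasurable.measurable_mk
    · simp only [Z', h, dite_false]
      exact measurable_const
  · rw [← Measure.map_congr (hae t ht)]
    exact (hlaw t ht).map_eq
  · exact hindep.congr fun t => hae t t.2

lemma ofReal_mul_le_div_mul (a b : ℝ) (ha : 0 ≤ a) {x : ℝ} (hx : x ≤ 1) :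
    ENNReal.ofReal (a * b) ≤ ENNReal.ofReal a / ENNReal.ofReal x * ENNReal.ofReal b := by
  rw [ENNReal.ofReal_mul ha]
  gcongr
  calc ENNReal.ofReal a = ENNReal.ofReal a / 1 := (div_one _).symm
    _ ≤ ENNReal.ofReal a / ENNReal.ofReal x :=
      ENNReal.div_le_div_left (ENNReal.ofReal_le_one.2 hx) _

end AveragedSGD

end

/-! ### Assembly of the bound -/

open AveragedSGD

theorem theorem2p1
    {E : Type*} [NormedAddCommGroup E] [InnerProductSpace ℝ E] [CompleteSpace E]
    [SecondCountableTopology E] [MeasurableSpace E] [BorelSpace E]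
    -- the distribution of `(x, y)`, and the optimum
    (D : Measure (E × ℝ)) [IsProbabilityMeasure D] (wStar : E)
    -- the sorted eigendecomposition of `H`, in dimension `d ≤ ∞`
    (d : ℕ∞) (v : HilbertBasis (AveragedSGD.BasisIndex d) ℝ E)
    (lam : AveragedSGD.BasisIndex d → ℝ)
    (heig : AveragedSGD.IsSortedEigendecomposition (AveragedSGD.secondMoment D) v lam)
    (hreg : AveragedSGD.Regularity D v wStar)
    (α : ℝ) (hfourth : AveragedSGD.FourthMomentBound D v α)
    -- `S = H^{-1/2} Σ H^{-1/2}`, so that `σ² = ‖S‖`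
    (S : E →L[ℝ] E) (hnoise : AveragedSGD.NoiseCondition D wStar S)
    -- the stepsize, the number of samples, and the initial point
    (γ : ℝ) (hγ_pos : 0 < γ)
    (hγ : γ ≤ 1 / (α * AveragedSGD.trace v (AveragedSGD.secondMoment D)))
    (N : ℕ) (hN : 0 < N) (w₀ : E)
    -- the samples `Z 1, …, Z N` are i.i.d. with distribution `D`
    {Ω : Type*} [MeasurableSpace Ω] (P : Measure Ω) [IsProbabilityMeasure P]
    (Z : ℕ → Ω → E × ℝ)
    (hlaw : ∀ t ∈ Set.Icc 1 N, HasLaw (Z t) D P)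
    (hindep : iIndepFun (fun t : Set.Icc 1 N => Z t) P) :
    Integrable (fun ω => AveragedSGD.risk D
        (AveragedSGD.average γ w₀ N (fun t => Z t ω))) P ∧
      ENNReal.ofReal
          ((∫ ω, AveragedSGD.risk D (AveragedSGD.average γ w₀ N (fun t => Z t ω)) ∂P) -
            AveragedSGD.risk D wStar) ≤
        2 * ENNReal.ofReal (AveragedSGD.effectiveBias v lam γ N
              (AveragedSGD.effectiveDim lam γ N) (w₀ - wStar)) +
          2 * AveragedSGD.effectiveVar lam α γ
              (AveragedSGD.trace v (AveragedSGD.secondMoment D)) ‖S‖ N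
              (AveragedSGD.effectiveDim lam γ N) (w₀ - wStar) := by
  have hN' : (0 : ℝ) < N := by exact_mod_cast hN
  obtain ⟨Z', hZ, hae⟩ := Samples.of_hasLaw hlaw hindep
  have havg : (fun ω => risk D (average γ w₀ N fun t => Z t ω)) =ᵐ[P]
      fun ω => risk D (average γ w₀ N fun t => Z' t ω) := by
    have h : ∀ᵐ ω ∂P, ∀ t ∈ Set.Icc 1 N, Z t ω = Z' t ω :=
      (ae_ball_iff (Set.to_countable _)).2 hae
    filter_upwards [h] with ω hω
    rw [average_congr hω]
  rw [integrable_congr havg, integral_congr_ae havg]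
  -- spectral facts
  have hα := hfourth.pos
  have hH := inner_secondMoment_comm hreg.memLp_two_x
  have hv : ∀ i x, inner ℝ (v i) (secondMoment D x) = lam i * inner ℝ (v i) x := fun i x => by
    rw [hH, heig.apply_eq, real_inner_smul_left]
  have hdiag : ∀ i, inner ℝ (v i) (secondMoment D (v i)) = lam i := fun i => by
    rw [hv, real_inner_self_eq_norm_sq, v.orthonormal.1 i]
    simp
  have hlam : ∀ i, 0 < lam i := fun i => by
    rw [← hdiag]
    exact hreg.posDef _ (v.orthonormal.ne_zero i)
  set τ := trace v (secondMoment D)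
  have hsum : HasSum lam τ := by
    rw [show lam = fun i => inner ℝ (v i) (secondMoment D (v i)) from
      funext fun i => (hdiag i).symm]
    exact hreg.summable_trace.hasSum
  -- If `τ = 0`, the convention `1 / 0 = 0` in `hγ` would force `γ ≤ 0`.
  have hτ : 0 < τ := by
    by_contra hneg
    have : 1 / (α * τ) ≤ 0 := one_div_nonpos.2 (mul_nonpos_of_nonneg_of_nonpos hα.le
      (not_lt.1 hneg))
    linarith
  have hr : γ * α * τ ≤ 1 := by
    have := (le_div_iff₀ (mul_pos hα hτ)).1 hγ
    linarith
  have hM0 := noiseModel_zero hreg hfourth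
  have hMξ := noiseModel_residual hreg hfourth hnoise
  have hγl : ∀ i, γ * lam i ≤ 1 := fun i => by
    have h1 : 1 ≤ α := hM0.one_le ((hlam i).trans_eq (hdiag i).symm)
    have h2 : lam i ≤ τ := le_hasSum hsum i fun j _ => (hlam j).le
    calc γ * lam i ≤ γ * τ := by gcongr
      _ ≤ γ * τ * α := le_mul_of_one_le_right (by positivity) h1
      _ ≤ 1 := by linarith
  -- the decomposition into bias and variance
  set u := w₀ - wStar
  set ξ : E × ℝ → ℝ := fun z => z.2 - inner ℝ wStar z.1
  set B : Ω → E := fun ω => (1 / (N : ℝ)) • ∑ t ∈ Finset.range N, err γ u (fun _ => 0) Z' t ω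
  set V : Ω → E := fun ω => (1 / (N : ℝ)) • ∑ t ∈ Finset.range N, err γ 0 ξ Z' t ω
  have hmB' := fun t => hZ.measurable_err hM0.measurable γ u t
  have hmV' := fun t => hZ.measurable_err hMξ.measurable γ 0 t
  have hmB : Measurable B := by fun_prop
  have hmV : Measurable V := by fun_prop
  have hB2 : Integrable (fun ω => ‖B ω‖ ^ 2) P := integrable_norm_smul_sum_sq hmB'
    (fun t ht => hM0.integrable_norm_err_sq hZ hγ_pos.le u ht.le) _
  have hV2 : Integrable (fun ω => ‖V ω‖ ^ 2) P := integrable_norm_smul_sum_sq hmV'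
    (fun t ht => hMξ.integrable_norm_err_sq hZ hγ_pos.le 0 ht.le) _
  have hBV2 : Integrable (fun ω => ‖(B + V) ω‖ ^ 2) P := by
    have hB' := (memLp_two_iff_integrable_sq_norm hmB.aestronglyMeasurable).2 hB2
    have hV' := (memLp_two_iff_integrable_sq_norm hmV.aestronglyMeasurable).2 hV2
    exact (memLp_two_iff_integrable_sq_norm (hmB.add hmV).aestronglyMeasurable).1 (hB'.add hV')
  have hrisk : ∀ ω, risk D (average γ w₀ N fun t => Z' t ω) =
      risk D wStar + (1 / 2) * inner ℝ ((B + V) ω) (secondMoment D ((B + V) ω)) := fun ω => by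
    rw [risk_sub_risk hreg.memLp_two_x hreg.memLp_two_y hreg.risk_le,
      average_sub_eq γ w₀ wStar hN Z' ω]
    rfl
  simp only [hrisk]
  have iBV := integrable_inner_apply (hmB.add hmV) hBV2 (secondMoment D)
  have iB := integrable_inner_apply hmB hB2 (secondMoment D)
  have iV := integrable_inner_apply hmV hV2 (secondMoment D)
  refine ⟨(integrable_const _).add (iBV.const_mul _), ?_⟩
  rw [integral_add (integrable_const _) (iBV.const_mul _), integral_const_mul]
  simp only [integral_const, probReal_univ, one_smul, add_sub_cancel_left]
  have hsplit : 1 / 2 * ∫ ω, inner ℝ ((B + V) ω) (secondMoment D ((B + V) ω)) ∂P ≤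
      ∫ ω, inner ℝ (B ω) (secondMoment D (B ω)) ∂P +
        ∫ ω, inner ℝ (V ω) (secondMoment D (V ω)) ∂P := by
    rw [← integral_add iB iV, ← integral_const_mul]
    refine integral_mono (iBV.const_mul _) (iB.add iV) fun ω => ?_
    have := inner_add_apply_add_le hreg.inner_nonneg (B ω) (V ω)
    simp only [Pi.add_apply]
    linarith
  set k := effectiveDim lam γ N
  have htail := tailSqSum_nonneg lam k
  -- bias
  have hbias : ∫ ω, inner ℝ (B ω) (secondMoment D (B ω)) ∂P ≤
      2 * (effectiveBias v lam γ N k u +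
        α * γ * ‖u‖ ^ 2 * (k / ((N : ℝ) ^ 2 * γ ^ 2) + tailSqSum lam k)) := by
    -- Here `K` is `α` times the bound `‖u‖² / γ` on the accumulated noiseless risk.
    have h := hM0.integral_average_le hZ hN hγ_pos (u := u) hH hv hlam hγl hsum.summable
      (Or.inr fun _ => rfl) (K := α * ‖u‖ ^ 2 / γ) (by positivity) (fun n hn => ?_) k hmB hB2
      fun ω => rfl
    · refine h.trans_eq ?_
      field_simp
    · have := hM0.sum_integral_le_of_noiseless hZ hγ_pos (u := u) hH hv hlam hsum hr
        (fun _ => rfl) hn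
      simp only [add_zero]
      rw [← Finset.mul_sum, le_div_iff₀ hγ_pos]
      have := mul_le_mul_of_nonneg_left this hα.le
      linarith
  -- variance
  have hvar_of : ∀ c : ℝ, 0 ≤ c → γ * (α * (c * τ) + ‖S‖) ≤ c →
      ∫ ω, inner ℝ (V ω) (secondMoment D (V ω)) ∂P ≤
        2 * ((α * (c * τ) + ‖S‖) * (k / (N : ℝ) + N * γ ^ 2 * tailSqSum lam k)) := by
    intro c hc0 hc
    have h0 : 0 ≤ α * (c * τ) + ‖S‖ := by positivity
    have h := hMξ.integral_average_le hZ hN hγ_pos (u := 0) hH hv hlam hγl hsum.summable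
      (Or.inl rfl) (K := N * (α * (c * τ) + ‖S‖)) (by positivity) (fun n hn => ?_) k hmV hV2
      fun ω => rfl
    · refine h.trans_eq ?_
      simp only [effectiveBias, headInvNormSq, tailNormSq, inner_zero_right]
      simp
      field_simp
    · calc ∑ t ∈ Finset.range n, (α * ∫ ω, inner ℝ (err γ 0 ξ Z' t ω)
            (secondMoment D (err γ 0 ξ Z' t ω)) ∂P + ‖S‖)
          ≤ ∑ t ∈ Finset.range n, (α * (c * τ) + ‖S‖) := by
            refine Finset.sum_le_sum fun t ht => ?_
            have := hMξ.integral_le_of_start_zero hZ hγ_pos hα.le hH hv hlam hγl hsum hc0 hc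
              ((Finset.mem_range.1 ht).le.trans hn)
            gcongr
        _ = n * (α * (c * τ) + ‖S‖) := by
          rw [Finset.sum_const, Finset.card_range, nsmul_eq_mul]
        _ ≤ N * (α * (c * τ) + ‖S‖) := by gcongr
  have hvar : ENNReal.ofReal (∫ ω, inner ℝ (V ω) (secondMoment D (V ω)) ∂P) ≤
      2 * (ENNReal.ofReal ‖S‖ / ENNReal.ofReal (1 - γ * α * τ) *
        ENNReal.ofReal (k / (N : ℝ) + N * γ ^ 2 * tailSqSum lam k)) := by
    have hY0 : 0 ≤ k / (N : ℝ) + N * γ ^ 2 * tailSqSum lam k := by positivity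
    rcases hr.lt_or_eq with hlt | heq
    · have hpos : 0 < 1 - γ * α * τ := sub_pos.2 hlt
      -- The fixed point of `c = γ (α c τ + ‖S‖)` is `γ‖S‖ / (1 - γατ)`.
      have hc : α * (γ * ‖S‖ / (1 - γ * α * τ) * τ) + ‖S‖ = ‖S‖ / (1 - γ * α * τ) := by
        rw [show α * (γ * ‖S‖ / (1 - γ * α * τ) * τ) = γ * α * τ * ‖S‖ / (1 - γ * α * τ) by ring,
          div_add' _ _ _ hpos.ne']
        congr 1
        ring
      have h := hvar_of (γ * ‖S‖ / (1 - γ * α * τ)) (by positivity)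
        (by rw [hc]; exact (mul_div_assoc _ _ _).ge)
      rw [hc] at h
      rw [← ENNReal.ofReal_div_of_pos hpos, ← ENNReal.ofReal_mul (by positivity),
        ← ENNReal.ofReal_ofNat 2, ← ENNReal.ofReal_mul zero_le_two]
      exact ENNReal.ofReal_le_ofReal h
    · rcases (norm_nonneg S).eq_or_lt with hS | hS
      · have h := hvar_of 0 le_rfl (by simp [← hS])
        simp only [zero_mul, mul_zero, ← hS, add_zero] at h
        rw [ENNReal.ofReal_of_nonpos h]
        exact bot_le
      · have hne : ∃ i : BasisIndex d, True := by
          by_contra hempty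
          push Not at hempty
          have : IsEmpty (BasisIndex d) := ⟨fun i => hempty i⟩
          exact hτ.ne' (hsum.unique hasSum_empty)
        obtain ⟨i, -⟩ := hne
        -- Since `∞ * 0 = 0` in `[0, ∞]`, the other factor must be nonzero for the right-hand side
        -- to be infinite. If `k = 0`, the tail contains every index, as indices start at `1`.
        have hY : 0 < k / (N : ℝ) + N * γ ^ 2 * tailSqSum lam k := by
          rcases Nat.eq_zero_or_pos k with hk | hk
          · have : 0 < tailSqSum lam k := by
              refine (summable_tail k (summable_sq_of_mul_le_one hγ_pos hlam hγl
                hsum.summable)).tsum_pos (fun j => by split_ifs <;> positivity) i ?_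
              have hi : k < (i : ℕ) := by
                have := i.2.1
                omega
              rw [if_pos hi]
              exact pow_pos (hlam i) 2
            positivity
          · have : (0 : ℝ) < k := by exact_mod_cast hk
            positivity
        rw [heq, sub_self, ENNReal.ofReal_zero, ENNReal.div_zero (ENNReal.ofReal_pos.2 hS).ne',
          ENNReal.top_mul (ENNReal.ofReal_pos.2 hY).ne']
        simp
  -- conclusion
  have hr0 : 1 - γ * α * τ ≤ 1 := sub_le_self _ (by positivity)
  have hbias' : ENNReal.ofReal (∫ ω, inner ℝ (B ω) (secondMoment D (B ω)) ∂P) ≤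
      2 * (ENNReal.ofReal (effectiveBias v lam γ N k u) +
        ENNReal.ofReal (α * γ * ‖u‖ ^ 2) / ENNReal.ofReal (1 - γ * α * τ) *
          ENNReal.ofReal (k / ((N : ℝ) ^ 2 * γ ^ 2) + tailSqSum lam k)) := by
    refine (ENNReal.ofReal_le_ofReal hbias).trans ?_
    rw [ENNReal.ofReal_mul zero_le_two, ENNReal.ofReal_ofNat]
    gcongr
    refine ENNReal.ofReal_add_le.trans ?_
    gcongr
    exact ofReal_mul_le_div_mul _ _ (by positivity) hr0
  calc _ ≤ _ := ENNReal.ofReal_le_ofReal hsplit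
    _ ≤ _ := ENNReal.ofReal_add_le
    _ ≤ _ := add_le_add hbias' hvar
    _ = _ := by
      rw [effectiveVar]
      ring
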